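/- Let $\mathcal H=L^2(\mathbb R^N)$, with inner product antilinear in the first argument, let $\mathfrak S(\mathbb R^N)\subset\mathcal H$ be the Schwartz space of complex functions with its usual topology, and let $\mathfrak S'(\mathbb R^N)$ be the space of tempered distributions with the weak-$*$ topology. On $\mathfrak S(\mathbb R^N)$ let $(Q_i\psi)(q)=q_i\psi(q)$, $P_i\psi=-i\,\partial\psi/\partial q_i$ and $H_i=\frac12(Q_i^2+P_i^2)$. For multi-indices $\alpha,\beta\in\mathbb N_0^N$ put $Q^\alpha=Q_1^{\alpha_1}\cdots Q_N^{\alpha_N}$, $P^\beta=P_1^{\beta_1}\cdots P_N^{\beta_N}$ and $(H+\frac12)^\beta=\prod_{i=1}^N(H_i+\frac12)^{\beta_i}$. The map $(H+\frac12)^\beta$ is a bijection of $\mathfrak S(\mathbb R^N)$ onto itself, whose inverse is denoted $(H+\frac12)^{-\beta}$. A bounded operator $T$ on $\mathcal H$ is a Schwartz operator if for all $\alpha,\alpha',\beta,\beta'\in\mathbb N_0^N$ $$\|T\|_{\alpha,\alpha',\beta,\beta'}=\sup\bigl\{|\langle P^\beta Q^\alpha\psi, T P^{\beta'}Q^{\alpha'}\varphi\rangle|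 : \psi,\varphi\in\mathfrak S(\mathbb R^N),\ \|\psi\|\le1,\ \|\varphi\|\le1\bigr\}<\infty .$$ Let $\mathfrak S(\mathcal H)$ be the space of Schwartz operators with the locally convex topology of these seminorms, and $\mathfrak S'(\mathcal H)$ the space of its continuous linear functionals. For $\psi,\psi'\in\mathfrak S(\mathbb R^N)$ the rank-one operator $|\psi\rangle\langle\psi'|:f\mapsto\langle\psi',f\rangle\psi$ belongs to $\mathfrak S(\mathcal H)$. Let $B$ be a sesquilinear form on $\mathfrak S(\mathbb R^N)\times\mathfrak S(\mathbb R^N)$ (antilinear in the first argument). The following conditions are equivalent: (i) $B$ is separately continuous in both arguments. (ii) $B$ is jointly continuous. (iii) There exist multi-indices $\beta,\beta'\in\mathbb N_0^N$ and a constant $C>0$ such that for all $\psi,\psi'\in\mathfrak S(\mathbb R^N)$ $$\bigl|B\bigl((H+\tfrac12)^{-\beta}\psi,(H+\tfrac12)^{-\beta'}\psi'\bigr)\bigr|\le C\|\psi\|\,\|\psi'\|,$$ where $\|\cdot\|$ is the norm of $\mathcal H$. (iv) There exist a Hilbert–Schmidt operator $A$ on $\mathcal H$ and polynomials $P_L,P_R$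 in the (noncommuting) operators $Q_1,\dots,Q_N,P_1,\dots,P_N$ such that $B(\psi,\psi')=\langle P_R^*\psi, A P_L\psi'\rangle$ for all $\psi,\psi'\in\mathfrak S(\mathbb R^N)$, where $P_R^*$ is the adjoint of $P_R$ restricted to $\mathfrak S(\mathbb R^N)$. Moreover, the relations $$B(\psi',\psi)=\Phi(|\psi\rangle\langle\psi'|)=\langle\psi',F\psi\rangle,\qquad \psi,\psi'\in\mathfrak S(\mathbb R^N),$$ establish one-to-one correspondences between the sesquilinear forms $B$ satisfying these equivalent conditions, the elements $\Phi\in\mathfrak S'(\mathcal H)$, and the continuous linear maps $F:\mathfrak S(\mathbb R^N)\to\mathfrak S'(\mathbb R^N)$. Here $\langle\psi',F\psi\rangle:=(F\psi)(\overline{\psi'})$. -/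

import Mathlib

open scoped SchwartzMap LineDeriv ComplexConjugate
open MeasureTheory

noncomputable section

namespace QHarm

/-- Configuration space `ℝ^N`. -/
abbrev Conf (N : ℕ) : Type := EuclideanSpace ℝ (Fin N)

/-- The Schwartz space `𝔖(ℝ^N)` of complex valued functions. -/
abbrev Sch (N : ℕ) : Type := 𝓢(Conf N, ℂ)

/-- The Hilbert space `𝓗 = L²(ℝ^N)` (Lebesgue measure). Its inner product `inner ℂ f g` is
antilinear in `f` and linear in `g`. -/
abbrev Hilb (N : ℕ) : Type := Lp ℂ 2 (volume : Measure (Conf N))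

/-- Multi-indices. -/
abbrev MultiIndex (N : ℕ) : Type := Fin N → ℕ

/-- A Schwartz function seen as a vector of `L²(ℝ^N)`. -/
def vec {N : ℕ} (ψ : Sch N) : Hilb N := SchwartzMap.toLpCLM ℂ ℂ 2 volume ψ

/-- Pointwise complex conjugation of Schwartz functions. -/
def conjSch {N : ℕ} (ψ : Sch N) : Sch N :=
  SchwartzMap.postcompCLM (Complex.conjCLE : ℂ →L[ℝ] ℂ) ψ

/-- The position operator `(Q_i ψ)(q) = q_i ψ(q)` on Schwartz functions. -/
def posOp {N : ℕ} (i : Fin N) : Sch N →L[ℂ] Sch N :=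
  SchwartzMap.smulLeftCLM ℂ (fun q : Conf N => ((q i : ℝ) : ℂ))

/-- The momentum operator `P_i ψ = -i ∂ψ/∂q_i` on Schwartz functions. -/
def momOp {N : ℕ} (i : Fin N) : Sch N →L[ℂ] Sch N :=
  (-Complex.I) • LineDeriv.lineDerivOpCLM ℂ (Sch N) (EuclideanSpace.single i (1 : ℝ))

/-- `A^α = A_1^{α_1} ⋯ A_N^{α_N}` for a tuple of operators on the Schwartz space. -/
def tuplePow {N : ℕ} (A : Fin N → (Sch N →L[ℂ] Sch N)) (α : MultiIndex N) :
    Sch N →L[ℂ] Sch N :=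
  (List.ofFn fun i => A i ^ α i).prod

/-- The one-mode oscillator `H_i = ½ (Q_i² + P_i²)`. -/
def oscOp {N : ℕ} (i : Fin N) : Sch N →L[ℂ] Sch N :=
  (1 / 2 : ℂ) • (posOp i ^ 2 + momOp i ^ 2)

/-- `(H + ½)^β = (H_1 + ½)^{β_1} ⋯ (H_N + ½)^{β_N}` on the Schwartz space. -/
def oscPow {N : ℕ} (β : MultiIndex N) : Sch N →L[ℂ] Sch N :=
  tuplePow (fun i => oscOp i + (1 / 2 : ℂ) • 1) β

/-- `(H + ½)^{-β}`, the inverse of `(H + ½)^β` on the Schwartz space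
(that `(H + ½)^β` is bijective there is part of the theorem). -/
def oscInvPow {N : ℕ} (β : MultiIndex N) : Sch N → Sch N :=
  Function.invFun (oscPow β)

/-- The polynomials in the (noncommuting) operators `Q_1, …, Q_N, P_1, …, P_N`. -/
def polyOps (N : ℕ) : Subalgebra ℂ (Sch N →L[ℂ] Sch N) :=
  Algebra.adjoin ℂ (Set.range posOp ∪ Set.range momOp)

/-- `R'` is the adjoint of `R` with respect to the `L²` inner product, on the Schwartz space.
It is uniquely determined by `R`. -/
def IsAdjointOn {N : ℕ} (R R' : Sch N →L[ℂ] Sch N) : Prop :=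
  ∀ φ ψ : Sch N, inner ℂ (vec (R' φ)) (vec ψ) = inner ℂ (vec φ) (vec (R ψ))

/-- Hilbert–Schmidt operators: `∑ ‖A b_i‖² < ∞` for some (equivalently, every)
orthonormal basis `b`. -/
def IsHilbertSchmidt {N : ℕ} (A : Hilb N →L[ℂ] Hilb N) : Prop :=
  ∃ (ι : Type) (b : HilbertBasis ι ℂ (Hilb N)), Summable fun i => ‖A (b i)‖ ^ 2

/-- Sesquilinear forms on `𝔖(ℝ^N) × 𝔖(ℝ^N)`, antilinear in the first argument. -/
abbrev SesqForm (N : ℕ) : Type := Sch N →ₗ⋆[ℂ] Sch N →ₗ[ℂ] ℂ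

def SeparatelyContinuous {N : ℕ} (B : SesqForm N) : Prop :=
  (∀ ψ' : Sch N, Continuous fun ψ : Sch N => B ψ ψ') ∧
    ∀ ψ : Sch N, Continuous fun ψ' : Sch N => B ψ ψ'

def JointlyContinuous {N : ℕ} (B : SesqForm N) : Prop :=
  Continuous fun p : Sch N × Sch N => B p.1 p.2

/-- Boundedness of the form after regularization by negative powers of `H + ½`. -/
def OscBounded {N : ℕ} (B : SesqForm N) : Prop :=
  ∃ β β' : MultiIndex N, ∃ C : ℝ, 0 < C ∧ ∀ ψ ψ' : Sch N,
    ‖B (oscInvPow β ψ) (oscInvPow β' ψ')‖ ≤ C * ‖vec ψ‖ * ‖vec ψ'‖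

/-- The form is `B(ψ,ψ') = ⟨P_R^* ψ, A P_L ψ'⟩` with `A` Hilbert–Schmidt and polynomials
`P_L`, `P_R` in the `Q_i`, `P_i`. -/
def HilbertSchmidtRegular {N : ℕ} (B : SesqForm N) : Prop :=
  ∃ A : Hilb N →L[ℂ] Hilb N, IsHilbertSchmidt A ∧
    ∃ PL ∈ polyOps N, ∃ PR ∈ polyOps N, ∃ PR' : Sch N →L[ℂ] Sch N, IsAdjointOn PR PR' ∧
      ∀ ψ ψ' : Sch N, B ψ ψ' = inner ℂ (vec (PR' ψ)) (A (vec (PL ψ')))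

/-! Schwartz operators. -/

/-- Indices `(α, α', β, β')` of the seminorms of Schwartz operators. -/
abbrev OpIndex (N : ℕ) : Type :=
  MultiIndex N × MultiIndex N × MultiIndex N × MultiIndex N

/-- `P^β Q^α` on the Schwartz space. -/
def momPos {N : ℕ} (β α : MultiIndex N) : Sch N →L[ℂ] Sch N :=
  tuplePow momOp β * tuplePow posOp α

/-- The set of numbers `|⟨P^β Q^α ψ, T P^β' Q^α' φ⟩|` with Schwartz functions `ψ`, `φ` of
`L²`-norm at most `1`. -/
def opValues {N : ℕ} (k : OpIndex N) (T : Hilb N →L[ℂ] Hilb N) : Set ℝ :=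
  {r | ∃ ψ φ : Sch N, ‖vec ψ‖ ≤ 1 ∧ ‖vec φ‖ ≤ 1 ∧
    r = ‖inner ℂ (vec (momPos k.2.2.1 k.1 ψ)) (T (vec (momPos k.2.2.2 k.2.1 φ)))‖}

lemma opValues_nonempty {N : ℕ} (k : OpIndex N) (T : Hilb N →L[ℂ] Hilb N) :
    (opValues k T).Nonempty :=
  ⟨_, 0, 0, by rw [vec, map_zero]; simp, by rw [vec, map_zero]; simp, rfl⟩

lemma opValues_zero_le {N : ℕ} (k : OpIndex N) (r : ℝ) (hr : r ∈ opValues k 0) : r ≤ 0 := by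
  obtain ⟨ψ, φ, -, -, rfl⟩ := hr
  simp

lemma opValues_add_le {N : ℕ} (k : OpIndex N) {S T : Hilb N →L[ℂ] Hilb N}
    (hS : BddAbove (opValues k S)) (hT : BddAbove (opValues k T))
    (r : ℝ) (hr : r ∈ opValues k (S + T)) : r ≤ sSup (opValues k S) + sSup (opValues k T) := by
  obtain ⟨ψ, φ, h1, h2, rfl⟩ := hr
  rw [add_apply, inner_add_right]
  exact (norm_add_le _ _).trans
    (add_le_add (le_csSup hS ⟨ψ, φ, h1, h2, rfl⟩) (le_csSup hT ⟨ψ, φ, h1, h2, rfl⟩))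

lemma opValues_smul_le {N : ℕ} (k : OpIndex N) (c : ℂ) {T : Hilb N →L[ℂ] Hilb N}
    (hT : BddAbove (opValues k T))
    (r : ℝ) (hr : r ∈ opValues k (c • T)) : r ≤ ‖c‖ * sSup (opValues k T) := by
  obtain ⟨ψ, φ, h1, h2, rfl⟩ := hr
  rw [smul_apply, inner_smul_right, norm_mul]
  exact mul_le_mul_of_nonneg_left (le_csSup hT ⟨ψ, φ, h1, h2, rfl⟩) (norm_nonneg _)

/-- The Schwartz operators, as a subspace of the bounded operators on `𝓗`. -/
def schwartzOps (N : ℕ) : Submodule ℂ (Hilb N →L[ℂ] Hilb N) where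
  carrier := {T | ∀ k : OpIndex N, BddAbove (opValues k T)}
  zero_mem' := fun k => ⟨0, opValues_zero_le k⟩
  add_mem' := fun hS hT k => ⟨_, opValues_add_le k (hS k) (hT k)⟩
  smul_mem' := fun c _ hT k => ⟨_, opValues_smul_le k c (hT k)⟩

/-- The space `𝔖(𝓗)` of Schwartz operators. It carries the topology of the seminorms below,
not the operator norm topology. -/
def SchwartzOp (N : ℕ) : Type := schwartzOps N

namespace SchwartzOp

variable {N : ℕ}

instance : AddCommGroup (SchwartzOp N) := inferInstanceAs (AddCommGroup (schwartzOps N))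

instance : Module ℂ (SchwartzOp N) := inferInstanceAs (Module ℂ (schwartzOps N))

/-- The bounded operator underlying a Schwartz operator. -/
def toOp (T : SchwartzOp N) : Hilb N →L[ℂ] Hilb N := Subtype.val T

/-- The seminorm `‖T‖_{α,α',β,β'} = sup |⟨P^β Q^α ψ, T P^β' Q^α' φ⟩|` over Schwartz functions
`ψ`, `φ` with `‖ψ‖, ‖φ‖ ≤ 1`. -/
def opSeminorm (N : ℕ) (k : OpIndex N) : Seminorm ℂ (SchwartzOp N) :=
  Seminorm.ofSMulLE (fun T => sSup (opValues k T.toOp))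
    (le_antisymm (csSup_le (opValues_nonempty k _) (opValues_zero_le k))
      (Real.sSup_nonneg (by rintro r ⟨ψ, φ, -, -, rfl⟩; exact norm_nonneg _)))
    (fun S T => csSup_le (opValues_nonempty k _)
      (opValues_add_le k (S.property k) (T.property k)))
    (fun c T => csSup_le (opValues_nonempty k _) (opValues_smul_le k c (T.property k)))

/-- The locally convex topology of `𝔖(𝓗)` defined by all the seminorms
`‖·‖_{α,α',β,β'}`. -/
instance : TopologicalSpace (SchwartzOp N) :=
  (SeminormFamily.moduleFilterBasis (opSeminorm N)).topology

lemma withSeminorms : WithSeminorms (opSeminorm N) := ⟨rfl⟩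

end SchwartzOp

/-- The space `𝔖'(𝓗)`: continuous linear functionals on the space of Schwartz operators. -/
abbrev OpDistribution (N : ℕ) : Type := SchwartzOp N →L[ℂ] ℂ

/-! Rank-one operators `|ψ⟩⟨ψ'|` with Schwartz `ψ`, `ψ'` are Schwartz operators. -/

lemma IsAdjointOn.mul {N : ℕ} {R R' S S' : Sch N →L[ℂ] Sch N}
    (hR : IsAdjointOn R R') (hS : IsAdjointOn S S') : IsAdjointOn (R * S) (S' * R') := by
  intro φ ψ
  rw [mul_apply_eq_comp, mul_apply_eq_comp, hS, hR]

lemma IsAdjointOn.one {N : ℕ} : IsAdjointOn (1 : Sch N →L[ℂ] Sch N) 1 := fun _ _ => rfl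

lemma exists_adjoint_pow {N : ℕ} {R R' : Sch N →L[ℂ] Sch N} (hR : IsAdjointOn R R') (n : ℕ) :
    IsAdjointOn (R ^ n) (R' ^ n) := by
  induction n with
  | zero => exact IsAdjointOn.one
  | succ n ih => rw [pow_succ, pow_succ']; exact ih.mul hR

lemma exists_adjoint_list {N : ℕ} (l : List (Sch N →L[ℂ] Sch N))
    (h : ∀ R ∈ l, ∃ R', IsAdjointOn R R') : ∃ R', IsAdjointOn l.prod R' := by
  induction l with
  | nil => exact ⟨1, IsAdjointOn.one⟩
  | cons R l ih =>
    obtain ⟨R', hR⟩ := h R (by simp)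
    obtain ⟨S', hS⟩ := ih fun S hS => h S (by simp [hS])
    exact ⟨S' * R', by rw [List.prod_cons]; exact hR.mul hS⟩

lemma exists_adjoint_tuplePow {N : ℕ} {A : Fin N → (Sch N →L[ℂ] Sch N)}
    (h : ∀ i, IsAdjointOn (A i) (A i)) (α : MultiIndex N) :
    ∃ R', IsAdjointOn (tuplePow A α) R' := by
  apply exists_adjoint_list
  intro R hR
  obtain ⟨i, rfl⟩ := (List.mem_ofFn' _ _).1 hR
  exact ⟨_, exists_adjoint_pow (h i) _⟩

lemma coord_hasTemperateGrowth {N : ℕ} (i : Fin N) :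
    Function.HasTemperateGrowth (fun q : Conf N => ((q i : ℝ) : ℂ)) :=
  (Complex.ofRealCLM ∘L (EuclideanSpace.proj i : Conf N →L[ℝ] ℝ)).hasTemperateGrowth

lemma posOp_apply {N : ℕ} (i : Fin N) (ψ : Sch N) (q : Conf N) :
    posOp i ψ q = (q i : ℂ) * ψ q := by
  rw [posOp, SchwartzMap.smulLeftCLM_apply_apply (coord_hasTemperateGrowth i), smul_eq_mul]

lemma momOp_apply {N : ℕ} (i : Fin N) (ψ : Sch N) (q : Conf N) :
    momOp i ψ q = -Complex.I * fderiv ℝ ψ q (EuclideanSpace.single i (1 : ℝ)) := by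
  simp [momOp, SchwartzMap.lineDerivOp_apply_eq_fderiv]

lemma conjSch_apply {N : ℕ} (ψ : Sch N) (q : Conf N) : conjSch ψ q = conj (ψ q) := rfl

lemma inner_vec {N : ℕ} (φ ψ : Sch N) :
    inner ℂ (vec φ) (vec ψ) = ∫ q, conj (φ q) * ψ q := by
  refine (SchwartzMap.inner_toL2_toL2_eq φ ψ volume).trans ?_
  simp [mul_comm]

lemma posOp_symmetric {N : ℕ} (i : Fin N) : IsAdjointOn (posOp (N := N) i) (posOp i) := by
  intro φ ψ
  rw [inner_vec, inner_vec]
  congr 1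
  ext q
  rw [posOp_apply, posOp_apply, map_mul, Complex.conj_ofReal]
  ring

lemma momOp_symmetric {N : ℕ} (i : Fin N) : IsAdjointOn (momOp (N := N) i) (momOp i) := by
  intro φ ψ
  rw [inner_vec, inner_vec]
  have key := SchwartzMap.integral_mul_lineDerivOp_right_eq_neg_left (μ := volume)
    (conjSch φ) ψ (EuclideanSpace.single i (1 : ℝ) : Conf N)
  have hconj : ∀ q : Conf N, (∂_{(EuclideanSpace.single i (1 : ℝ) : Conf N)} (conjSch φ)) q
      = conj ((∂_{(EuclideanSpace.single i (1 : ℝ) : Conf N)} φ) q) := by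
    intro q
    rw [SchwartzMap.lineDerivOp_apply_eq_fderiv, SchwartzMap.lineDerivOp_apply_eq_fderiv]
    have h := ((Complex.conjCLE : ℂ →L[ℝ] ℂ).hasFDerivAt.comp q (φ.hasFDerivAt q)).fderiv
    have h2 : ⇑(conjSch φ) = (Complex.conjCLE : ℂ →L[ℝ] ℂ) ∘ φ := rfl
    rw [h2, h]
    rfl
  have h1 : ∀ q, conj (momOp i φ q) * ψ q = Complex.I *
      ((∂_{(EuclideanSpace.single i (1 : ℝ) : Conf N)} (conjSch φ)) q * ψ q) := by
    intro q
    rw [hconj, momOp_apply, SchwartzMap.lineDerivOp_apply_eq_fderiv]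
    simp [mul_assoc]
  have h2 : ∀ q, conj (φ q) * momOp i ψ q = -Complex.I *
      (conjSch φ q * (∂_{(EuclideanSpace.single i (1 : ℝ) : Conf N)} ψ) q) := by
    intro q
    rw [momOp_apply, SchwartzMap.lineDerivOp_apply_eq_fderiv, conjSch_apply]
    ring
  simp_rw [h1, h2]
  rw [integral_const_mul, integral_const_mul, key]
  ring

lemma exists_adjoint_momPos {N : ℕ} (β α : MultiIndex N) :
    ∃ R', IsAdjointOn (momPos (N := N) β α) R' := by
  obtain ⟨R, hR⟩ := exists_adjoint_tuplePow momOp_symmetric β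
  obtain ⟨S, hS⟩ := exists_adjoint_tuplePow posOp_symmetric α
  exact ⟨_, hR.mul hS⟩

lemma rankOne_mem {N : ℕ} (ψ ψ' : Sch N) :
    InnerProductSpace.rankOne ℂ (vec ψ) (vec ψ') ∈ schwartzOps N := by
  intro k
  obtain ⟨R, hR⟩ := exists_adjoint_momPos k.2.2.1 k.1
  obtain ⟨S, hS⟩ := exists_adjoint_momPos k.2.2.2 k.2.1
  refine ⟨‖vec (S ψ')‖ * ‖vec (R ψ)‖, ?_⟩
  rintro r ⟨χ, φ, hχ, hφ, rfl⟩
  rw [InnerProductSpace.rankOne_apply, inner_smul_right, norm_mul, ← hS,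
    norm_inner_symm (vec (momPos _ _ χ)), ← hR]
  refine mul_le_mul ?_ ?_ (norm_nonneg _) (norm_nonneg _)
  · exact (norm_inner_le_norm _ _).trans (mul_le_of_le_one_right (norm_nonneg _) hφ)
  · exact (norm_inner_le_norm _ _).trans (mul_le_of_le_one_right (norm_nonneg _) hχ)

/-- The Schwartz operator `|ψ⟩⟨ψ'|`, that is `f ↦ ⟨ψ', f⟩ ψ`. -/
def ketbra {N : ℕ} (ψ ψ' : Sch N) : SchwartzOp N :=
  ⟨InnerProductSpace.rankOne ℂ (vec ψ) (vec ψ'), rankOne_mem ψ ψ'⟩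

end QHarm

end

/-! The harmonic oscillator diagonalises everything. The commuting operators H_i + ½ are bounded
below by 1 and have the Hermite functions h_α as eigenvectors, with eigenvalues α_i + 1. Every
polynomial in the Q_i, P_i is dominated by a power of H + ½ (`polyOps_le_oscDominated`), and a
Sobolev inequality replaces sup norms by L² norms. Hence the norms ‖(H + ½)^β ψ‖ define the topology
of 𝔖 (`withSeminorms_osc`), Hermite expansions converge in 𝔖 (`hasSum_herm`), and each (H + ½)^β is
bijective (`oscPow_bijective`).

Equivalences. Since 𝔖 is a Fréchet space, Banach–Steinhaus upgrades separate continuity to joint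
continuity. Joint continuity at the origin is a bound |B(ψ,ψ')| ≤ C ‖(H + ½)^β ψ‖ ‖(H + ½)^β' ψ'‖,
which is (iii) after a substitution. For (iv), two more powers of H + ½ in every mode make the
Hermite matrix of B decay like a product of inverse squares. Such a matrix is a Hilbert–Schmidt
operator, and the powers taken out are polynomials in Q, P.

Correspondences. Maps F into 𝔖' with the weak-* topology are separately continuous forms, hence
covered by the equivalence. For functionals Φ, normal ordering shows that the seminorms of 𝔖(𝓗)
control ⟨R ψ, T S φ⟩ for all polynomials R, S. The Hermite matrix of a Schwartz operator T is
therefore rapidly decreasing, and T = Σ T_mn |h_m⟩⟨h_n| in 𝔖(𝓗) (`hasSum_ketbra`). This makes Φ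
unique, and Φ(T) = Σ T_mn B(h_n, h_m) makes it exist (`JointlyContinuous.exists_distribution`). -/

noncomputable section

namespace QHarm

/-! ### The Schwartz space is complete and Baire. -/

section Completeness

open Filter Topology

variable {E F : Type*} [NormedAddCommGroup E] [NormedSpace ℝ E]
  [NormedAddCommGroup F] [NormedSpace ℝ F]

lemma iteratedFDeriv_schwartz_sub (f g : 𝓢(E, F)) (l : ℕ) (x : E) :
    iteratedFDeriv ℝ l (f - g) x = iteratedFDeriv ℝ l f x - iteratedFDeriv ℝ l g x := by
  have := iteratedFDeriv_sub_apply (𝕜 := ℝ) (i := l) (x := x)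
    (f.contDiffAt l) (g.contDiffAt l)
  rw [← this]; rfl

/-- A sequence of Schwartz functions whose increments decrease geometrically in all seminorms
converges in the Schwartz space. -/
lemma exists_tendsto_of_controlled [CompleteSpace F] (u : ℕ → 𝓢(E, F))
    (hu : ∀ N m n, N ≤ m → N ≤ n → ∀ k ≤ N, ∀ l ≤ N,
      SchwartzMap.seminorm ℝ k l (u m - u n) ≤ (1 / 2) ^ N) :
    ∃ f, Tendsto u atTop (𝓝 f) := by
  set d : ℕ → 𝓢(E, F) := fun n => u (n + 1) - u n with hd
  set v : ℕ → ℕ → ℝ := fun l n => SchwartzMap.seminorm ℝ 0 l (d n) with hv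
  have hsum : ∀ l, Summable (v l) := fun l => by
    refine Summable.of_norm_bounded_eventually_nat (g := fun n => (1 / 2 : ℝ) ^ n)
      (summable_geometric_of_lt_one (by norm_num) (by norm_num)) ?_
    filter_upwards [eventually_ge_atTop l] with n hn
    rw [Real.norm_of_nonneg (apply_nonneg _ _)]
    exact hu n (n + 1) n (by omega) le_rfl 0 (by omega) l hn
  have hbd : ∀ l n x, ‖iteratedFDeriv ℝ l (d n) x‖ ≤ v l n := fun l n x =>
    SchwartzMap.norm_iteratedFDeriv_le_seminorm ℝ (d n) l x
  have hsm : ∀ n, ContDiff ℝ (⊤ : ℕ∞) (d n) := fun n => (d n).smooth ⊤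
  -- The limit is written as a telescoping series, so that smoothness and the termwise derivatives
  -- follow from summable uniform bounds on the derivatives of the increments.
  set s : E → F := fun x => ∑' n, d n x with hs
  have hs_smooth : ContDiff ℝ (⊤ : ℕ∞) s :=
    contDiff_tsum hsm (fun k _ => hsum k) (fun k i x _ => hbd k i x)
  set f : E → F := fun x => u 0 x + s x with hf
  have hf_smooth : ContDiff ℝ (⊤ : ℕ∞) f := ((u 0).smooth ⊤).add hs_smooth
  have hlim : ∀ l x, Tendsto (fun n => iteratedFDeriv ℝ l (u n) x) atTop
      (𝓝 (iteratedFDeriv ℝ l f x)) := fun l x => by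
    have h1 : iteratedFDeriv ℝ l f x
        = iteratedFDeriv ℝ l (u 0) x + ∑' n, iteratedFDeriv ℝ l (d n) x := by
      rw [← iteratedFDeriv_tsum_apply hsm (fun k _ => hsum k) (fun k i x _ => hbd k i x)
        (by exact_mod_cast le_top) x]
      exact iteratedFDeriv_add_apply ((u 0).contDiffAt l)
        ((hs_smooth.of_le (by exact_mod_cast le_top)).contDiffAt)
    have h2 : Summable fun n => iteratedFDeriv ℝ l (d n) x :=
      Summable.of_norm_bounded (hsum l) (fun n => hbd l n x)
    rw [h1]
    refine (h2.hasSum.tendsto_sum_nat.const_add _).congr fun n => ?_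
    simp only [hd, iteratedFDeriv_schwartz_sub]
    rw [Finset.sum_range_sub (fun n => iteratedFDeriv ℝ l (u n) x)]
    abel
  have hclose : ∀ N n, N ≤ n → ∀ k ≤ N, ∀ l ≤ N, ∀ x,
      ‖x‖ ^ k * ‖iteratedFDeriv ℝ l f x - iteratedFDeriv ℝ l (u n) x‖ ≤ (1 / 2) ^ N := by
    intro N n hn k hk l hl x
    -- The Cauchy estimate between `u m` and `u n` passes to the pointwise limit in `m`, with the
    -- same constant for every `x`.
    refine le_of_tendsto (((hlim l x).sub_const _).norm.const_mul _) ?_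
    filter_upwards [eventually_ge_atTop N] with m hm
    rw [← iteratedFDeriv_schwartz_sub]
    exact (SchwartzMap.le_seminorm ℝ k l _ x).trans (hu N m n hm hn k hk l hl)
  let fS : 𝓢(E, F) := ⟨f, hf_smooth, fun k l => by
    refine ⟨(1 / 2) ^ (max k l) + SchwartzMap.seminorm ℝ k l (u (max k l)), fun x => ?_⟩
    have h1 := hclose (max k l) _ le_rfl k (le_max_left _ _) l (le_max_right _ _) x
    have h2 := SchwartzMap.le_seminorm ℝ k l (u (max k l)) x
    refine le_trans ?_ (add_le_add h1 h2)
    rw [← mul_add]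
    gcongr
    exact norm_le_norm_sub_add _ _⟩
  refine ⟨fS, ((schwartz_withSeminorms ℝ E F).tendsto_nhds_atTop u fS).2 ?_⟩
  rintro ⟨k, l⟩ ε hε
  obtain ⟨M, hM⟩ := exists_pow_lt_of_lt_one hε (by norm_num : (1 / 2 : ℝ) < 1)
  refine ⟨max M (max k l), fun n hn => ?_⟩
  refine lt_of_le_of_lt (SchwartzMap.seminorm_le_bound ℝ k l (u n - fS)
    (M := (1 / 2) ^ (max M (max k l))) (by positivity) fun x => ?_)
    (lt_of_le_of_lt (pow_le_pow_of_le_one (by norm_num) (by norm_num) (le_max_left _ _)) hM)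
  rw [iteratedFDeriv_schwartz_sub, norm_sub_rev]
  exact hclose _ n hn k (by simp) l (by simp) x

instance schwartz_isCountablyGenerated : (uniformity 𝓢(E, F)).IsCountablyGenerated :=
  IsUniformAddGroup.uniformity_countably_generated

instance schwartz_completeSpace [CompleteSpace F] : CompleteSpace 𝓢(E, F) := by
  have hcont : ∀ k l, Continuous (SchwartzMap.seminorm ℝ k l : Seminorm ℝ 𝓢(E, F)) :=
    fun k l => (schwartz_withSeminorms ℝ E F).continuous_seminorm (k, l)
  refine UniformSpace.complete_of_convergent_controlled_sequences
    (fun N => {p : 𝓢(E, F) × 𝓢(E, F) | ∀ k ∈ Set.Iic N, ∀ l ∈ Set.Iic N,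
      SchwartzMap.seminorm ℝ k l (p.2 - p.1) < (1 / 2) ^ N}) (fun N => ?_) fun u hu =>
        exists_tendsto_of_controlled u fun N m n hm hn k hk l hl =>
          (hu N n m hn hm k hk l hl).le
  rw [uniformity_eq_comap_nhds_zero]
  refine ⟨{f | ∀ k ∈ Set.Iic N, ∀ l ∈ Set.Iic N, SchwartzMap.seminorm ℝ k l f < (1 / 2) ^ N},
    ?_, fun p hp => hp⟩
  refine (eventually_all_finite (Set.finite_Iic N)).2 fun k _ =>
    (eventually_all_finite (Set.finite_Iic N)).2 fun l _ => ?_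
  have := (hcont k l).tendsto (0 : 𝓢(E, F))
  rw [map_zero] at this
  exact this.eventually_lt_const (by positivity)

/-- Baire category is what Banach–Steinhaus needs in `SeparatelyContinuous.jointlyContinuous`. -/
instance schwartz_baireSpace [CompleteSpace F] : BaireSpace 𝓢(E, F) := by
  let := UniformSpace.pseudoMetricSpace 𝓢(E, F)
  infer_instance

end Completeness

/-! ### Gaussians as Schwartz functions. -/

section Gaussian

variable {E : Type*} [NormedAddCommGroup E] [InnerProductSpace ℝ E]

/-- Since (1 + t)^k ≤ e^{kt}, completing the square in kt − bt² gives the bound e^{k²/(4b)}. -/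
lemma exists_pow_mul_exp_neg_sq_le {b : ℝ} (hb : 0 < b) (k : ℕ) :
    ∃ C, ∀ t : ℝ, 0 ≤ t → (1 + t) ^ k * Real.exp (-(b * t ^ 2)) ≤ C := by
  refine ⟨Real.exp (k ^ 2 / (4 * b)), fun t ht => ?_⟩
  have h1 : (1 + t) ^ k ≤ Real.exp (k * t) := by
    rw [mul_comm, Real.exp_mul, Real.rpow_natCast]
    exact pow_le_pow_left₀ (by positivity) (by linarith [Real.add_one_le_exp t]) k
  refine (mul_le_mul_of_nonneg_right h1 (Real.exp_nonneg _)).trans ?_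
  rw [← Real.exp_add]
  refine Real.exp_le_exp.2 ?_
  rw [le_div_iff₀ (by positivity)]
  nlinarith [sq_nonneg (k - 2 * b * t)]

/-- The Gaussian `exp (-b ‖x‖²)` as a Schwartz function. -/
def gaussianSchwartz (b : ℝ) (hb : 0 < b) : 𝓢(E, ℂ) where
  toFun x := Complex.exp (((-(b * ‖x‖ ^ 2) : ℝ)) : ℂ)
  smooth' := by
    have : ContDiff ℝ (⊤ : ℕ∞) fun x : E => -(b * ‖x‖ ^ 2) :=
      (contDiff_const.mul (contDiff_norm_sq ℝ)).neg
    exact (Complex.ofRealCLM.contDiff.comp this).cexp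
  decay' k n := by
    have hsm : ContDiff ℝ (⊤ : ℕ∞) fun x : E => -(b * ‖x‖ ^ 2) :=
      (contDiff_const.mul (contDiff_norm_sq ℝ)).neg
    have htemp : Function.HasTemperateGrowth fun x : E => -(b * ‖x‖ ^ 2) := by
      fun_prop
    obtain ⟨j, C, hC, hj⟩ := htemp.norm_iteratedFDeriv_le_uniform n
    obtain ⟨K, hK⟩ := exists_pow_mul_exp_neg_sq_le hb (k + j * n)
    refine ⟨n.factorial * (1 + C) ^ n * K, fun x => ?_⟩
    have hone : 1 ≤ (1 + ‖x‖) ^ j := one_le_pow₀ (by linarith [norm_nonneg x])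
    have hreal : ‖iteratedFDeriv ℝ n (fun x : E => Real.exp (-(b * ‖x‖ ^ 2))) x‖
        ≤ n.factorial * Real.exp (-(b * ‖x‖ ^ 2)) * ((1 + C) * (1 + ‖x‖) ^ j) ^ n := by
      -- Faà di Bruno estimate: all derivatives of exp equal exp, and the i-th derivative of the
      -- exponent must be at most D^i. The summand 1 in D = (1 + C)(1 + ‖x‖)^j ensures D ≥ 1, hence
      -- D ≤ D^i for i ≥ 1.
      refine norm_iteratedFDeriv_comp_le (g := Real.exp) (N := (⊤ : ℕ∞))
        Real.contDiff_exp hsm (by exact_mod_cast le_top) x (fun i _ => ?_) (fun i hi hin => ?_)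
      · rw [norm_iteratedFDeriv_eq_norm_iteratedDeriv, iteratedDeriv_eq_iterate,
          Real.iter_deriv_exp, Real.norm_of_nonneg (Real.exp_nonneg _)]
      · refine ((hj i hin x).trans ?_).trans (le_self_pow₀ ?_ (by omega))
        · gcongr; linarith
        · nlinarith
    have hcoe : (fun x : E => Complex.exp (((-(b * ‖x‖ ^ 2) : ℝ)) : ℂ))
        = Complex.ofRealLI ∘ fun x : E => Real.exp (-(b * ‖x‖ ^ 2)) := by
      ext x; simp
    have hexp : ContDiff ℝ (⊤ : ℕ∞) fun x : E => Real.exp (-(b * ‖x‖ ^ 2)) := hsm.exp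
    rw [hcoe, LinearIsometry.norm_iteratedFDeriv_comp_left _ hexp.contDiffAt
      (by exact_mod_cast le_top)]
    calc ‖x‖ ^ k * _ ≤ (1 + ‖x‖) ^ k *
          (n.factorial * Real.exp (-(b * ‖x‖ ^ 2)) * ((1 + C) * (1 + ‖x‖) ^ j) ^ n) := by
          gcongr; linarith [norm_nonneg x]
      _ = n.factorial * (1 + C) ^ n *
          ((1 + ‖x‖) ^ (k + j * n) * Real.exp (-(b * ‖x‖ ^ 2))) := by
          rw [mul_pow, pow_add, pow_mul]; ring
      _ ≤ _ := by gcongr; exact hK _ (norm_nonneg x)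

lemma gaussianSchwartz_apply {b : ℝ} (hb : 0 < b) (x : E) :
    gaussianSchwartz b hb x = Complex.exp (((-(b * ‖x‖ ^ 2) : ℝ)) : ℂ) := rfl

end Gaussian

variable {N : ℕ}

/-! ### Canonical commutation relations and ladder operators. -/

section Commutation

lemma posOp_mul_posOp (i j : Fin N) : posOp i * posOp j = posOp j * posOp i := by
  ext ψ q
  simp only [mul_apply_eq_comp, posOp_apply]
  ring

lemma lineDerivOp_comm (v w : Conf N) (ψ : Sch N) : ∂_{v} (∂_{w} ψ) = ∂_{w} (∂_{v} ψ) := by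
  ext q
  have key : ∀ v w : Conf N, (∂_{v} (∂_{w} ψ) : Sch N) q = fderiv ℝ (fderiv ℝ ψ) q v w := by
    intro v w
    rw [SchwartzMap.lineDerivOp_apply_eq_fderiv]
    have h1 : ⇑(∂_{w} ψ : Sch N) = fun y => fderiv ℝ ψ y w := by
      ext y; rw [SchwartzMap.lineDerivOp_apply_eq_fderiv]
    have h2 : DifferentiableAt ℝ (fderiv ℝ ψ) q :=
      ((ψ.smooth 2).fderiv_right (m := 1) (by norm_num)).differentiable (by norm_num) q
    rw [h1, fderiv_clm_apply h2 (differentiableAt_const w)]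
    simp
  have hsymm : IsSymmSndFDerivAt ℝ ψ q :=
    (ψ.contDiffAt 2).isSymmSndFDerivAt (by simp)
  rw [key, key, hsymm.eq]

lemma momOp_mul_momOp (i j : Fin N) : momOp i * momOp j = momOp j * momOp i := by
  ext1 ψ
  simp only [mul_apply_eq_comp, momOp, smul_apply, map_smul, LineDeriv.lineDerivOpCLM_apply]
  rw [lineDerivOp_comm]

/-- The product rule yields [Q_i, P_j] = i δ_ij. With the commutativity of the Q's and of the P's,
it makes all later commutators pure algebra. -/
lemma posOp_mul_momOp (i j : Fin N) :
    posOp i * momOp j = momOp j * posOp i + (if i = j then Complex.I else 0) • 1 := by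
  ext ψ q
  have h1 : ⇑(posOp i ψ) = fun y : Conf N => ((y i : ℝ) : ℂ) * ψ y := by
    ext y; rw [posOp_apply]
  have h2 : HasFDerivAt (fun y : Conf N => ((y i : ℝ) : ℂ))
      (Complex.ofRealCLM ∘L (EuclideanSpace.proj i : Conf N →L[ℝ] ℝ)) q :=
    (Complex.ofRealCLM ∘L (EuclideanSpace.proj i : Conf N →L[ℝ] ℝ)).hasFDerivAt
  have h3 : fderiv ℝ (fun y : Conf N => ((y i : ℝ) : ℂ) * ψ y) q = _ :=
    (h2.mul (ψ.hasFDerivAt q)).fderiv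
  simp only [mul_apply_eq_comp, add_apply, smul_apply, one_apply_eq_self, posOp_apply,
    momOp_apply, h1]
  rw [h3]
  rcases eq_or_ne i j with rfl | hij
  · simp
    ring
  · simp [hij]
    ring

/-- Annihilation operators (unnormalised). -/
def annOp (i : Fin N) : Sch N →L[ℂ] Sch N := posOp i + Complex.I • momOp i

/-- Creation operators (unnormalised). -/
def creOp (i : Fin N) : Sch N →L[ℂ] Sch N := posOp i - Complex.I • momOp i

/-- The shifted oscillators `H_i + ½`. -/
def shiftedOsc (i : Fin N) : Sch N →L[ℂ] Sch N := oscOp i + (1 / 2 : ℂ) • 1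

lemma annOp_mul_creOp (i j : Fin N) :
    annOp i * creOp j = creOp j * annOp i + (if i = j then (2 : ℂ) else 0) • 1 := by
  simp only [annOp, creOp, add_mul, mul_sub, sub_mul, mul_add, smul_mul_assoc, mul_smul_comm,
    smul_smul, Complex.I_mul_I, posOp_mul_momOp, posOp_mul_posOp i j, momOp_mul_momOp i j,
    smul_add]
  by_cases h : i = j
  · subst h
    match_scalars <;> ring_nf <;> simp [Complex.I_sq]; norm_num
  · simp only [if_neg h, if_neg (Ne.symm h)]
    match_scalars <;> ring_nf <;> simp [Complex.I_sq]

lemma creOp_mul_creOp (i j : Fin N) : creOp i * creOp j = creOp j * creOp i := by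
  simp only [creOp, mul_sub, sub_mul, smul_mul_assoc, mul_smul_comm,
    smul_smul, Complex.I_mul_I, posOp_mul_momOp, posOp_mul_posOp i j, momOp_mul_momOp i j,
    smul_add, smul_sub]
  by_cases h : i = j
  · subst h
    match_scalars <;> ring_nf
  · simp only [if_neg h, if_neg (Ne.symm h)]
    match_scalars <;> ring_nf

lemma annOp_mul_annOp (i j : Fin N) : annOp i * annOp j = annOp j * annOp i := by
  simp only [annOp, mul_add, add_mul, smul_mul_assoc, mul_smul_comm,
    smul_smul, Complex.I_mul_I, posOp_mul_momOp, posOp_mul_posOp i j, momOp_mul_momOp i j,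
    smul_add]
  by_cases h : i = j
  · subst h
    match_scalars <;> ring_nf
  · simp only [if_neg h, if_neg (Ne.symm h)]
    match_scalars <;> ring_nf

/-- (Q + iP)(Q − iP) = Q² + P² − i[Q, P] = Q² + P² + 1, so the shift by ½ is exactly the commutator
term. -/
lemma shiftedOsc_eq (i : Fin N) : shiftedOsc i = (1 / 2 : ℂ) • (annOp i * creOp i) := by
  simp only [annOp, creOp, shiftedOsc, oscOp, add_mul, mul_sub, smul_mul_assoc, mul_smul_comm,
    smul_smul, Complex.I_mul_I, posOp_mul_momOp, if_true, pow_two, smul_add, smul_sub]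
  module

lemma shiftedOsc_mul_creOp (i j : Fin N) :
    shiftedOsc i * creOp j = creOp j * shiftedOsc i + (if i = j then (1 : ℂ) else 0) • creOp j := by
  rw [shiftedOsc_eq, smul_mul_assoc, mul_assoc, creOp_mul_creOp i j, ← mul_assoc, annOp_mul_creOp,
    add_mul, mul_assoc, mul_smul_comm]
  split_ifs with h
  · subst h
    simp only [smul_mul_assoc, one_mul]
    module
  · simp

lemma shiftedOsc_mul_annOp (i j : Fin N) :
    shiftedOsc i * annOp j = annOp j * shiftedOsc i - (if i = j then (1 : ℂ) else 0) • annOp j := by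
  have h := annOp_mul_creOp j i
  rw [← sub_eq_iff_eq_add] at h
  rw [shiftedOsc_eq, smul_mul_assoc, mul_assoc, ← h, mul_sub, ← mul_assoc, annOp_mul_annOp i j,
    mul_assoc, mul_smul_comm, mul_smul_comm]
  by_cases h : i = j
  · subst h
    simp only [mul_one, if_true]
    module
  · simp [h, Ne.symm h]

lemma shiftedOsc_commute (i j : Fin N) : Commute (shiftedOsc i) (shiftedOsc j) := by
  rw [Commute, SemiconjBy, shiftedOsc_eq j, mul_smul_comm, ← mul_assoc, shiftedOsc_mul_annOp,
    sub_mul, mul_assoc, shiftedOsc_mul_creOp, smul_mul_assoc, smul_mul_assoc]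
  simp only [mul_add, mul_smul_comm, mul_assoc]
  module

end Commutation

/-! ### Adjoints and basic L² estimates for the oscillator. -/

section Inner

lemma vec_add (φ ψ : Sch N) : vec (φ + ψ) = vec φ + vec ψ := map_add _ _ _

lemma vec_sub (φ ψ : Sch N) : vec (φ - ψ) = vec φ - vec ψ := map_sub _ _ _

lemma vec_smul (c : ℂ) (ψ : Sch N) : vec (c • ψ) = c • vec ψ := map_smul _ _ _

lemma vec_sum {ι : Type*} (s : Finset ι) (f : ι → Sch N) :
    vec (∑ i ∈ s, f i) = ∑ i ∈ s, vec (f i) := map_sum _ _ _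

lemma continuous_vec : Continuous (vec : Sch N → Hilb N) :=
  (SchwartzMap.toLpCLM ℂ ℂ 2 volume).continuous

lemma vec_injective : Function.Injective (vec : Sch N → Hilb N) :=
  SchwartzMap.injective_toLp 2 (volume : Measure (Conf N))

lemma IsAdjointOn.add {R R' S S' : Sch N →L[ℂ] Sch N}
    (hR : IsAdjointOn R R') (hS : IsAdjointOn S S') : IsAdjointOn (R + S) (R' + S') := by
  intro φ ψ
  rw [add_apply, add_apply, vec_add, vec_add, inner_add_left, inner_add_right, hR, hS]

lemma IsAdjointOn.smul {R R' : Sch N →L[ℂ] Sch N}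
    (hR : IsAdjointOn R R') (c : ℂ) : IsAdjointOn (c • R) (conj c • R') := by
  intro φ ψ
  rw [smul_apply, smul_apply, vec_smul, vec_smul, inner_smul_left, inner_smul_right, hR,
    Complex.conj_conj]

lemma IsAdjointOn.symm {R R' : Sch N →L[ℂ] Sch N} (hR : IsAdjointOn R R') :
    IsAdjointOn R' R := by
  intro φ ψ
  rw [← inner_conj_symm, ← hR, inner_conj_symm]

lemma annOp_adjoint (i : Fin N) : IsAdjointOn (annOp i) (creOp i) := by
  have h := (posOp_symmetric i).add ((momOp_symmetric (N := N) i).smul Complex.I)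
  rwa [Complex.conj_I, neg_smul, ← sub_eq_add_neg] at h

lemma shiftedOsc_symmetric (i : Fin N) : IsAdjointOn (shiftedOsc i) (shiftedOsc i) := by
  have h := ((annOp_adjoint i).mul (annOp_adjoint i).symm).smul (1 / 2 : ℂ)
  rw [← shiftedOsc_eq] at h
  rwa [map_div₀, map_one, Complex.conj_ofNat, ← shiftedOsc_eq] at h

lemma exists_adjoint_mem_polyOps {R : Sch N →L[ℂ] Sch N} (hR : R ∈ polyOps N) :
    ∃ R' ∈ polyOps N, IsAdjointOn R R' := by
  induction hR using Algebra.adjoin_induction with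
  | mem x hx =>
    refine ⟨x, Algebra.subset_adjoin hx, ?_⟩
    rcases hx with ⟨i, rfl⟩ | ⟨i, rfl⟩
    exacts [posOp_symmetric i, momOp_symmetric i]
  | algebraMap r =>
    refine ⟨algebraMap ℂ _ (conj r), Subalgebra.algebraMap_mem _ _, ?_⟩
    rw [Algebra.algebraMap_eq_smul_one, Algebra.algebraMap_eq_smul_one]
    exact IsAdjointOn.one.smul r
  | add x y _ _ hx hy =>
    obtain ⟨x', hx', h1⟩ := hx
    obtain ⟨y', hy', h2⟩ := hy
    exact ⟨_, add_mem hx' hy', h1.add h2⟩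
  | mul x y _ _ hx hy =>
    obtain ⟨x', hx', h1⟩ := hx
    obtain ⟨y', hy', h2⟩ := hy
    exact ⟨_, mul_mem hy' hx', h1.mul h2⟩

lemma inner_vec_self (φ : Sch N) : inner ℂ (vec φ) (vec φ) = ((‖vec φ‖ ^ 2 : ℝ) : ℂ) := by
  rw [inner_self_eq_norm_sq_to_K]; norm_cast

lemma norm_creOp_sq (i : Fin N) (φ : Sch N) :
    ‖vec (creOp i φ)‖ ^ 2 = 2 * (inner ℂ (vec φ) (vec (shiftedOsc i φ))).re := by
  have h := annOp_adjoint i φ (creOp i φ)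
  rw [inner_vec_self] at h
  rw [shiftedOsc_eq, smul_apply, vec_smul, inner_smul_right, mul_apply_eq_comp, ← h]
  rw [Complex.re_mul_ofReal]
  norm_num
  ring

/-- Reversing the order of the ladder operators costs the commutator 2. The resulting term 2‖φ‖² is
the source of the lower bound H_i + ½ ≥ 1. -/
lemma norm_annOp_sq (i : Fin N) (φ : Sch N) :
    ‖vec (annOp i φ)‖ ^ 2 + 2 * ‖vec φ‖ ^ 2
      = 2 * (inner ℂ (vec φ) (vec (shiftedOsc i φ))).re := by
  have h := (annOp_adjoint i).symm φ (annOp i φ)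
  have h2 : shiftedOsc i = (1 / 2 : ℂ) • (creOp i * annOp i) + 1 := by
    rw [shiftedOsc_eq, annOp_mul_creOp, if_pos rfl]
    module
  rw [inner_vec_self] at h
  rw [h2, add_apply, vec_add, inner_add_right, smul_apply, vec_smul, inner_smul_right,
    mul_apply_eq_comp, ← h, one_apply_eq_self, inner_vec_self]
  rw [Complex.add_re, Complex.re_mul_ofReal, Complex.ofReal_re]
  norm_num
  ring

/-- ‖φ‖² ≤ Re ⟨φ, (H_i + ½)φ⟩ ≤ ‖φ‖ ‖(H_i + ½)φ‖. Injectivity of H_i + ½ and monotonicity of the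
norms ‖(H + ½)^β ψ‖ in β both rest on this. -/
lemma norm_le_norm_shiftedOsc (i : Fin N) (φ : Sch N) :
    ‖vec φ‖ ≤ ‖vec (shiftedOsc i φ)‖ := by
  have h1 := norm_annOp_sq i φ
  have h2 : (inner ℂ (vec φ) (vec (shiftedOsc i φ))).re ≤ ‖vec φ‖ * ‖vec (shiftedOsc i φ)‖ :=
    (Complex.re_le_norm _).trans (norm_inner_le_norm _ _)
  by_contra! h3
  have h4 := norm_nonneg (vec (shiftedOsc i φ))
  nlinarith [sq_nonneg ‖vec (annOp i φ)‖]

lemma norm_creOp_le (i : Fin N) (φ : Sch N) :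
    ‖vec (creOp i φ)‖ ≤ 2 * ‖vec (shiftedOsc i φ)‖ := by
  have h1 := norm_creOp_sq i φ
  have h2 : (inner ℂ (vec φ) (vec (shiftedOsc i φ))).re ≤ ‖vec φ‖ * ‖vec (shiftedOsc i φ)‖ :=
    (Complex.re_le_norm _).trans (norm_inner_le_norm _ _)
  have h3 := norm_le_norm_shiftedOsc i φ
  refine le_of_sq_le_sq ?_ (by positivity)
  nlinarith [norm_nonneg (vec φ)]

lemma norm_annOp_le (i : Fin N) (φ : Sch N) :
    ‖vec (annOp i φ)‖ ≤ 2 * ‖vec (shiftedOsc i φ)‖ := by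
  have h1 := norm_annOp_sq i φ
  have h2 : (inner ℂ (vec φ) (vec (shiftedOsc i φ))).re ≤ ‖vec φ‖ * ‖vec (shiftedOsc i φ)‖ :=
    (Complex.re_le_norm _).trans (norm_inner_le_norm _ _)
  have h3 := norm_le_norm_shiftedOsc i φ
  refine le_of_sq_le_sq ?_ (by positivity)
  nlinarith [norm_nonneg (vec φ), sq_nonneg ‖vec φ‖]

end Inner

/-! ### Polynomials in Q and P are dominated by powers of H + ½. -/

section Words

lemma tuplePow_eq_map (A : Fin N → (Sch N →L[ℂ] Sch N)) (α : MultiIndex N) :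
    tuplePow A α = ((List.finRange N).map fun i => A i ^ α i).prod := by
  rw [tuplePow, List.ofFn_eq_map]

lemma tuplePow_zero (A : Fin N → (Sch N →L[ℂ] Sch N)) : tuplePow A 0 = 1 := by
  rw [tuplePow_eq_map]
  exact List.prod_eq_one (by simp)

lemma tuplePow_add {A : Fin N → (Sch N →L[ℂ] Sch N)} (hA : ∀ i j, Commute (A i) (A j))
    (α β : MultiIndex N) : tuplePow A (α + β) = tuplePow A α * tuplePow A β := by
  simp only [tuplePow_eq_map]
  induction List.finRange N with
  | nil => simp
  | cons i l ih =>
    have h : Commute (A i ^ β i) (l.map fun j => A j ^ α j).prod := by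
      refine Commute.list_prod_right _ _ fun x hx => ?_
      obtain ⟨j, -, rfl⟩ := List.mem_map.1 hx
      exact (hA i j).pow_pow _ _
    rw [List.map_cons, List.prod_cons, ih, List.map_cons, List.prod_cons, List.map_cons,
      List.prod_cons, Pi.add_apply, pow_add]
    simp only [mul_assoc]
    rw [← mul_assoc (A i ^ β i), h.eq, mul_assoc]

lemma tuplePow_single (A : Fin N → (Sch N →L[ℂ] Sch N)) (i : Fin N) (k : ℕ) :
    tuplePow A (Pi.single i k) = A i ^ k := by
  have key : ∀ l : List (Fin N), l.Nodup →
      (l.map fun j => A j ^ (Pi.single i k : MultiIndex N) j).prod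
        = if i ∈ l then A i ^ k else 1 := by
    intro l hl
    induction l with
    | nil => simp
    | cons j l ih =>
      rw [List.nodup_cons] at hl
      rw [List.map_cons, List.prod_cons, ih hl.2]
      rcases eq_or_ne i j with rfl | hij
      · simp [hl.1]
      · simp [hij]
  rw [tuplePow_eq_map, key _ (List.nodup_finRange N), if_pos (List.mem_finRange i)]

lemma oscPow_eq (β : MultiIndex N) : oscPow β = tuplePow shiftedOsc β := rfl

lemma oscPow_zero : oscPow (0 : MultiIndex N) = 1 := tuplePow_zero _

lemma oscPow_add (α β : MultiIndex N) : oscPow (α + β) = oscPow α * oscPow β :=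
  tuplePow_add shiftedOsc_commute α β

lemma oscPow_add_apply (α β : MultiIndex N) (ψ : Sch N) :
    oscPow (α + β) ψ = oscPow α (oscPow β ψ) := by
  rw [oscPow_add, mul_apply_eq_comp]

lemma oscPow_single (i : Fin N) : oscPow (Pi.single i 1) = shiftedOsc (N := N) i := by
  rw [oscPow_eq, tuplePow_single, pow_one]

lemma multiIndex_induction {p : MultiIndex N → Prop} (h0 : p 0)
    (hs : ∀ i α, p α → p (Pi.single i 1 + α)) (α : MultiIndex N) : p α := by
  induction h : ∑ i, α i generalizing α with
  | zero =>
    have : α = 0 := by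
      ext i
      exact (Finset.sum_eq_zero_iff.1 h) i (Finset.mem_univ i)
    rwa [this]
  | succ n ih =>
    obtain ⟨i, hi⟩ : ∃ i, α i ≠ 0 := by
      by_contra! hc
      simp [hc] at h
    have hα : α = Pi.single i 1 + (α - Pi.single i 1) := by
      rw [add_comm]
      refine (tsub_add_cancel_of_le fun j => ?_).symm
      rcases eq_or_ne j i with rfl | hj
      · simpa using Nat.one_le_iff_ne_zero.2 hi
      · simp [hj]
    rw [hα]
    refine hs i _ (ih _ ?_)
    have h2 : ∑ j, α j = 1 + ∑ j, (α - Pi.single i 1 : MultiIndex N) j := by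
      conv_lhs => rw [hα]
      simp [Finset.sum_add_distrib]
    omega

lemma norm_oscPow_le_add (α β : MultiIndex N) (ψ : Sch N) :
    ‖vec (oscPow β ψ)‖ ≤ ‖vec (oscPow (α + β) ψ)‖ := by
  induction α using multiIndex_induction with
  | h0 => rw [zero_add]
  | hs i α ih =>
    rw [add_assoc, oscPow_add_apply, oscPow_single]
    exact ih.trans (norm_le_norm_shiftedOsc i _)

lemma norm_oscPow_mono {α β : MultiIndex N} (h : α ≤ β) (ψ : Sch N) :
    ‖vec (oscPow α ψ)‖ ≤ ‖vec (oscPow β ψ)‖ := by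
  rw [← tsub_add_cancel_of_le h]
  exact norm_oscPow_le_add _ _ _

lemma norm_le_norm_oscPow (β : MultiIndex N) (ψ : Sch N) :
    ‖vec ψ‖ ≤ ‖vec (oscPow β ψ)‖ := by
  have h := norm_oscPow_le_add β 0 ψ
  rwa [add_zero, oscPow_zero, one_apply_eq_self] at h

lemma oscPow_symmetric (β : MultiIndex N) : IsAdjointOn (oscPow β) (oscPow β) := by
  induction β using multiIndex_induction with
  | h0 => rw [oscPow_zero]; exact IsAdjointOn.one
  | hs i α ih =>
    have h := (shiftedOsc_symmetric i).mul ih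
    rw [← oscPow_single, ← oscPow_add, ← oscPow_add] at h
    rwa [add_comm α] at h

/-- Operators on the Schwartz space that are bounded for the scale of norms
`ψ ↦ ‖(H + ½)^β ψ‖`. -/
def oscDominated (N : ℕ) : Subalgebra ℂ (Sch N →L[ℂ] Sch N) where
  carrier := {W | ∀ β, ∃ γ, ∃ C : ℝ, 0 ≤ C ∧
    ∀ ψ, ‖vec (oscPow β (W ψ))‖ ≤ C * ‖vec (oscPow γ ψ)‖}
  mul_mem' := by
    intro V W hV hW β
    obtain ⟨γ, C, hC, h1⟩ := hV β
    obtain ⟨δ, D, hD, h2⟩ := hW γ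
    refine ⟨δ, C * D, by positivity, fun ψ => ?_⟩
    rw [mul_apply_eq_comp, mul_assoc]
    exact (h1 _).trans (mul_le_mul_of_nonneg_left (h2 ψ) hC)
  add_mem' := by
    intro V W hV hW β
    obtain ⟨γ, C, hC, h1⟩ := hV β
    obtain ⟨δ, D, hD, h2⟩ := hW β
    refine ⟨γ + δ, C + D, by positivity, fun ψ => ?_⟩
    rw [add_apply, map_add, vec_add, add_mul]
    refine (norm_add_le _ _).trans (add_le_add ((h1 ψ).trans ?_) ((h2 ψ).trans ?_))
    · exact mul_le_mul_of_nonneg_left (norm_oscPow_mono le_self_add ψ) hC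
    · exact mul_le_mul_of_nonneg_left (norm_oscPow_le_add γ δ ψ) hD
  algebraMap_mem' := by
    intro r β
    refine ⟨β, ‖r‖, norm_nonneg r, fun ψ => ?_⟩
    rw [Algebra.algebraMap_eq_smul_one, smul_apply, one_apply_eq_self, map_smul, vec_smul,
      norm_smul]

/-- The factors of (H + ½)^β are pushed through `A` one at a time. Each passage leaves a remainder
that is a multiple of `A` with one factor fewer, so it at most doubles the constant, and `A` itself
finally costs one factor H_i + ½. -/
lemma ladder_mem_oscDominated {A : Sch N →L[ℂ] Sch N} {i : Fin N} {c : Fin N → ℂ}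
    (hc : ∀ j, ‖c j‖ ≤ 1) (hA : ∀ j, shiftedOsc j * A = A * shiftedOsc j + c j • A)
    (hbd : ∀ φ, ‖vec (A φ)‖ ≤ 2 * ‖vec (shiftedOsc i φ)‖) : A ∈ oscDominated N := by
  have key : ∀ β, ∃ C : ℝ, 0 ≤ C ∧
      ∀ ψ, ‖vec (oscPow β (A ψ))‖ ≤ C * ‖vec (oscPow (Pi.single i 1 + β) ψ)‖ := by
    intro β
    induction β using multiIndex_induction with
    | h0 =>
      refine ⟨2, by norm_num, fun ψ => ?_⟩
      rw [oscPow_zero, one_apply_eq_self, add_zero, oscPow_single]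
      exact hbd ψ
    | hs j β ih =>
      obtain ⟨C, hC, h⟩ := ih
      refine ⟨C + C, by positivity, fun ψ => ?_⟩
      have h1 : oscPow (Pi.single j 1 + β) (A ψ)
          = oscPow β (A (shiftedOsc j ψ)) + c j • oscPow β (A ψ) := by
        rw [add_comm, oscPow_add_apply, oscPow_single, ← mul_apply_eq_comp (shiftedOsc j), hA,
          add_apply, smul_apply, map_add, map_smul, mul_apply_eq_comp]
      rw [h1, vec_add, vec_smul, add_mul]
      refine (norm_add_le _ _).trans (add_le_add ((h _).trans ?_) ?_)
      · rw [← oscPow_single j, ← oscPow_add_apply]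
        rw [show Pi.single i 1 + β + Pi.single j 1
          = (Pi.single i 1 + (Pi.single j 1 + β) : MultiIndex N) by abel]
      · rw [norm_smul]
        refine (mul_le_of_le_one_left (norm_nonneg _) (hc j)).trans ((h ψ).trans ?_)
        refine mul_le_mul_of_nonneg_left (norm_oscPow_mono ?_ ψ) hC
        exact add_le_add_right le_add_self _
  exact fun β => ⟨_, key β⟩

lemma annOp_mem_oscDominated (i : Fin N) : annOp i ∈ oscDominated N := by
  refine ladder_mem_oscDominated (i := i) (c := fun j => -(if j = i then 1 else 0))
    (fun j => ?_) (fun j => ?_) (norm_annOp_le i)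
  · split_ifs <;> simp
  · rw [shiftedOsc_mul_annOp, neg_smul, sub_eq_add_neg]

lemma creOp_mem_oscDominated (i : Fin N) : creOp i ∈ oscDominated N := by
  refine ladder_mem_oscDominated (i := i) (c := fun j => (if j = i then 1 else 0))
    (fun j => ?_) (fun j => ?_) (norm_creOp_le i)
  · split_ifs <;> simp
  · rw [shiftedOsc_mul_creOp]

lemma posOp_eq_ladder (i : Fin N) : posOp i = (1 / 2 : ℂ) • (annOp i + creOp i) := by
  rw [annOp, creOp]; module

lemma momOp_eq_ladder (i : Fin N) : momOp i = (-Complex.I / 2) • (annOp i - creOp i) := by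
  rw [annOp, creOp]
  match_scalars <;> ring_nf
  simp [Complex.I_sq]

lemma polyOps_le_oscDominated : polyOps N ≤ oscDominated N := by
  refine Algebra.adjoin_le ?_
  rintro _ (⟨i, rfl⟩ | ⟨i, rfl⟩)
  · rw [posOp_eq_ladder]
    exact Subalgebra.smul_mem _
      (add_mem (annOp_mem_oscDominated i) (creOp_mem_oscDominated i)) _
  · rw [momOp_eq_ladder]
    exact Subalgebra.smul_mem _
      (sub_mem (annOp_mem_oscDominated i) (creOp_mem_oscDominated i)) _

lemma norm_polyOp_le {W : Sch N →L[ℂ] Sch N} (hW : W ∈ polyOps N) :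
    ∃ γ, ∃ C : ℝ, 0 ≤ C ∧ ∀ ψ, ‖vec (W ψ)‖ ≤ C * ‖vec (oscPow γ ψ)‖ := by
  obtain ⟨γ, C, hC, h⟩ := polyOps_le_oscDominated hW 0
  exact ⟨γ, C, hC, fun ψ => by simpa only [oscPow_zero, one_apply_eq_self] using h ψ⟩

lemma posOp_mem_polyOps (i : Fin N) : posOp i ∈ polyOps N :=
  Algebra.subset_adjoin (Or.inl ⟨i, rfl⟩)

lemma momOp_mem_polyOps (i : Fin N) : momOp i ∈ polyOps N :=
  Algebra.subset_adjoin (Or.inr ⟨i, rfl⟩)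

lemma tuplePow_mem_polyOps {A : Fin N → (Sch N →L[ℂ] Sch N)} (hA : ∀ i, A i ∈ polyOps N)
    (α : MultiIndex N) : tuplePow A α ∈ polyOps N := by
  refine list_prod_mem fun x hx => ?_
  obtain ⟨i, rfl⟩ := (List.mem_ofFn' _ _).1 hx
  exact pow_mem (hA i) _

lemma shiftedOsc_mem_polyOps (i : Fin N) : shiftedOsc i ∈ polyOps N :=
  add_mem (Subalgebra.smul_mem _ (add_mem (pow_mem (posOp_mem_polyOps i) 2)
    (pow_mem (momOp_mem_polyOps i) 2)) _) (Subalgebra.smul_mem _ (one_mem _) _)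

lemma oscPow_mem_polyOps (β : MultiIndex N) : oscPow β ∈ polyOps N :=
  tuplePow_mem_polyOps shiftedOsc_mem_polyOps β

lemma momPos_mem_polyOps (β α : MultiIndex N) : momPos β α ∈ polyOps N :=
  mul_mem (tuplePow_mem_polyOps momOp_mem_polyOps β) (tuplePow_mem_polyOps posOp_mem_polyOps α)

end Words

/-! ### The norms ‖(H + ½)^β ψ‖ define the Schwartz topology. -/

section Sobolev

open FourierTransform

/-- The operator `1 + ∑ P_i²`. -/
def oneAddMomSq (N : ℕ) : Sch N →L[ℂ] Sch N := 1 + ∑ i, momOp i ^ 2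

/-- The operator `1 + ∑ Q_i²`. -/
def oneAddPosSq (N : ℕ) : Sch N →L[ℂ] Sch N := 1 + ∑ i, posOp i ^ 2

lemma oneAddMomSq_mem : oneAddMomSq N ∈ polyOps N :=
  add_mem (one_mem _) (sum_mem fun i _ => pow_mem (momOp_mem_polyOps i) 2)

lemma oneAddPosSq_mem : oneAddPosSq N ∈ polyOps N :=
  add_mem (one_mem _) (sum_mem fun i _ => pow_mem (posOp_mem_polyOps i) 2)

lemma sum_coord_sq (x : Conf N) : ∑ i, ((x i : ℝ) : ℂ) ^ 2 = ((‖x‖ ^ 2 : ℝ) : ℂ) := by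
  rw [EuclideanSpace.norm_sq_eq]
  push_cast
  refine Finset.sum_congr rfl fun i _ => ?_
  rw [Real.norm_eq_abs, ← Complex.ofReal_pow, ← Complex.ofReal_pow, sq_abs]

lemma schwartz_sum_apply {ι : Type*} (s : Finset ι) (f : ι → Sch N) (x : Conf N) :
    (∑ i ∈ s, f i) x = ∑ i ∈ s, f i x := by
  induction s using Finset.cons_induction with
  | empty => simp
  | cons a s ha ih => rw [Finset.sum_cons, Finset.sum_cons, add_apply, ih]

lemma oneAddPosSq_pow_apply (k : ℕ) (ψ : Sch N) (x : Conf N) :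
    (oneAddPosSq N ^ k) ψ x = ((1 + ‖x‖ ^ 2 : ℝ) : ℂ) ^ k * ψ x := by
  induction k generalizing ψ with
  | zero => simp
  | succ k ih =>
    rw [pow_succ (oneAddPosSq N), mul_apply_eq_comp, ih, pow_succ (_ : ℂ) k, mul_assoc]
    congr 1
    rw [oneAddPosSq, add_apply, one_apply_eq_self, add_apply, sum_apply, schwartz_sum_apply]
    simp only [pow_two, mul_apply_eq_comp, posOp_apply]
    simp only [← mul_assoc, ← Finset.sum_mul]
    have := sum_coord_sq x
    simp only [pow_two] at this
    rw [this]
    push_cast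
    ring

lemma fourierInv_momOp_apply (i : Fin N) (ψ : Sch N) (ξ : Conf N) :
    (𝓕⁻ (momOp i ψ)) ξ = (-(2 * Real.pi) * ξ i : ℂ) * (𝓕⁻ ψ) ξ := by
  have h : 𝓕⁻ (momOp i ψ) = (-Complex.I) • 𝓕⁻ (∂_{EuclideanSpace.single i (1 : ℝ)} ψ) := by
    rw [← FourierTransform.fourierInv_smul]; rfl
  have hg : Function.HasTemperateGrowth
      (fun x : Conf N => inner ℝ x (EuclideanSpace.single i (1 : ℝ))) := by fun_prop
  rw [h, SchwartzMap.fourierInv_lineDerivOp_eq, smul_apply, smul_apply,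
    SchwartzMap.smulLeftCLM_apply_apply hg]
  simp only [EuclideanSpace.inner_single_right, one_mul, smul_eq_mul, Complex.real_smul]
  simp
  linear_combination (2 * Real.pi * ξ i * (𝓕⁻ ψ) ξ : ℂ) * Complex.I_sq

lemma fourierInv_oneAddMomSq_pow_apply (k : ℕ) (ψ : Sch N) (ξ : Conf N) :
    (𝓕⁻ ((oneAddMomSq N ^ k) ψ)) ξ
      = ((1 + (2 * Real.pi) ^ 2 * ‖ξ‖ ^ 2 : ℝ) : ℂ) ^ k * (𝓕⁻ ψ) ξ := by
  induction k generalizing ψ with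
  | zero => simp
  | succ k ih =>
    rw [pow_succ (oneAddMomSq N), mul_apply_eq_comp, ih, pow_succ (_ : ℂ) k, mul_assoc]
    congr 1
    rw [oneAddMomSq, add_apply, one_apply_eq_self, sum_apply, FourierTransform.fourierInv_add,
      FourierTransform.fourierInv_sum, add_apply, schwartz_sum_apply]
    simp only [pow_two, mul_apply_eq_comp, fourierInv_momOp_apply]
    simp only [← mul_assoc, ← Finset.sum_mul]
    have h1 : ∑ i, (-(2 * Real.pi) * ξ i * -(2 * Real.pi) * ξ i : ℂ)
        = (2 * Real.pi) ^ 2 * ((‖ξ‖ ^ 2 : ℝ) : ℂ) := by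
      rw [← sum_coord_sq, Finset.mul_sum]
      exact Finset.sum_congr rfl fun i _ => by ring
    rw [h1]
    push_cast
    ring

lemma integral_norm_sq_eq (φ : Sch N) : ∫ x, ‖φ x‖ ^ 2 = ‖vec φ‖ ^ 2 := by
  have h := inner_vec_self φ
  rw [inner_vec] at h
  have h2 : ∀ x, conj (φ x) * φ x = ((‖φ x‖ ^ 2 : ℝ) : ℂ) := fun x => by
    rw [mul_comm, Complex.mul_conj, Complex.normSq_eq_norm_sq]
  simp_rw [h2] at h
  rw [integral_complex_ofReal] at h
  exact_mod_cast h

lemma norm_vec_fourierInv (φ : Sch N) : ‖vec (𝓕⁻ φ)‖ = ‖vec φ‖ := by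
  have h := SchwartzMap.norm_fourier_toL2_eq (𝓕⁻ φ)
  rw [FourierTransform.fourier_fourierInv_eq] at h
  exact h.symm

/-- Sobolev inequality: the supremum of a Schwartz function is controlled by the `L²` norm of
sufficiently many derivatives. -/
lemma exists_norm_apply_le (N : ℕ) :
    ∃ C : ℝ, 0 ≤ C ∧ ∀ (ψ : Sch N) (x : Conf N),
      ‖ψ x‖ ≤ C * ‖vec ((oneAddMomSq N ^ (N + 1)) ψ)‖ := by
  -- The sup norm of ψ is at most the L¹ norm of its inverse Fourier transform, to which
  -- Cauchy–Schwarz is applied with the weight `w`. The exponent N + 1 makes `w` square integrable: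
  -- w² decays like ‖ξ‖^(−4(N+1)) and 4(N + 1) > N.
  set w : Conf N → ℝ := fun ξ => ((1 + ‖ξ‖ ^ 2) ^ (N + 1))⁻¹ with hw
  have hw0 : ∀ ξ, 0 ≤ w ξ := fun ξ => by positivity
  have hwc : Continuous w := by
    refine Continuous.inv₀ (by fun_prop) fun ξ => by positivity
  have hwL : MemLp w 2 volume := by
    rw [memLp_two_iff_integrable_sq hwc.aestronglyMeasurable]
    have h := integrable_rpow_neg_one_add_norm_sq (E := Conf N) (μ := volume)
      (r := ((4 * (N + 1) : ℕ) : ℝ)) (by simp only [finrank_euclideanSpace_fin]; norm_cast; omega)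
    refine h.congr (Filter.Eventually.of_forall fun ξ => ?_)
    have : (-((4 * (N + 1) : ℕ) : ℝ) / 2) = -((2 * (N + 1) : ℕ) : ℝ) := by push_cast; ring
    simp only [hw]
    rw [this, Real.rpow_neg (by positivity), Real.rpow_natCast, inv_pow, ← pow_mul, mul_comm 2]
  refine ⟨(∫ ξ, w ξ ^ (2 : ℝ)) ^ (1 / 2 : ℝ), by positivity, fun ψ x => ?_⟩
  set f := 𝓕⁻ ψ with hf
  set g := 𝓕⁻ ((oneAddMomSq N ^ (N + 1)) ψ) with hg
  have h1 : ‖ψ x‖ ≤ ∫ ξ, ‖f ξ‖ := by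
    have h := SchwartzMap.norm_fourier_apply_le_toLp_one f x
    rwa [hf, FourierTransform.fourier_fourierInv_eq, SchwartzMap.norm_toLp_one] at h
  have h2 : ∀ ξ, ‖f ξ‖ ≤ w ξ * ‖g ξ‖ := fun ξ => by
    rw [hg, fourierInv_oneAddMomSq_pow_apply, norm_mul, norm_pow, ← mul_assoc]
    refine le_mul_of_one_le_left (norm_nonneg _) ?_
    simp only [hw]
    rw [inv_mul_eq_div, one_le_div (by positivity), Complex.norm_real,
      Real.norm_of_nonneg (by positivity)]
    gcongr
    refine le_mul_of_one_le_left (by positivity) (one_le_pow₀ ?_)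
    linarith [Real.pi_gt_three]
  have hgL : MemLp (fun ξ => ‖g ξ‖) 2 volume := (g.memLp 2 volume).norm
  have h3 := integral_mul_le_Lp_mul_Lq_of_nonneg (μ := (volume : Measure (Conf N)))
    (p := 2) (q := 2) ⟨by norm_num, by norm_num, by norm_num⟩ (f := w) (g := fun ξ => ‖g ξ‖)
    (Filter.Eventually.of_forall hw0) (Filter.Eventually.of_forall fun ξ => norm_nonneg _)
    (by simpa using hwL) (by simpa using hgL)
  have h4 : (∫ ξ, ‖g ξ‖ ^ (2 : ℝ)) ^ (1 / 2 : ℝ) = ‖vec ((oneAddMomSq N ^ (N + 1)) ψ)‖ := by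
    have : ∫ ξ, ‖g ξ‖ ^ (2 : ℝ) = ‖vec g‖ ^ 2 := by
      rw [← integral_norm_sq_eq]
      simp
    rw [this, hg, norm_vec_fourierInv, ← Real.sqrt_eq_rpow, Real.sqrt_sq (norm_nonneg _)]
  rw [h4] at h3
  exact h1.trans ((integral_mono f.integrable.norm (hwL.integrable_mul hgL) h2).trans h3)

lemma exists_norm_polyOp_apply_le {W : Sch N →L[ℂ] Sch N} (hW : W ∈ polyOps N) :
    ∃ γ, ∃ C : ℝ, 0 ≤ C ∧ ∀ ψ x, ‖W ψ x‖ ≤ C * ‖vec (oscPow γ ψ)‖ := by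
  obtain ⟨C, hC, h⟩ := exists_norm_apply_le N
  obtain ⟨γ, D, hD, h2⟩ := norm_polyOp_le (mul_mem (pow_mem oneAddMomSq_mem (N + 1)) hW)
  refine ⟨γ, C * D, by positivity, fun ψ x => (h _ x).trans ?_⟩
  rw [mul_assoc]
  exact mul_le_mul_of_nonneg_left (h2 ψ) hC

/-- Since ∂_i = i P_i, mixed partial derivatives are polynomial operators. -/
lemma exists_iteratedFDeriv_basis {n : ℕ} (c : Fin n → Fin N) :
    ∃ W ∈ polyOps N, ∀ ψ : Sch N, ∀ x,
      iteratedFDeriv ℝ n ψ x (fun j => EuclideanSpace.single (c j) (1 : ℝ)) = W ψ x := by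
  suffices h : ∃ W ∈ polyOps N, ∀ ψ : Sch N,
      ∂^{fun j => (EuclideanSpace.single (c j) (1 : ℝ) : Conf N)} ψ = W ψ by
    obtain ⟨W, hW, h⟩ := h
    refine ⟨W, hW, fun ψ x => ?_⟩
    rw [← h, SchwartzMap.iteratedLineDerivOp_eq_iteratedFDeriv]
  induction n with
  | zero => exact ⟨1, one_mem _, fun ψ => by simp⟩
  | succ n ih =>
    obtain ⟨W, hW, h⟩ := ih (Fin.tail c)
    refine ⟨(Complex.I • momOp (c 0)) * W,
      mul_mem (Subalgebra.smul_mem _ (momOp_mem_polyOps _) _) hW, fun ψ => ?_⟩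
    rw [LineDeriv.iteratedLineDerivOp_succ_left, mul_apply_eq_comp, ← h, momOp, smul_smul,
      mul_neg, Complex.I_mul_I, neg_neg, one_smul]
    rfl

lemma norm_multilinear_le_sum {n : ℕ} (f : (Conf N) [×n]→L[ℝ] ℂ) :
    ‖f‖ ≤ ∑ c : Fin n → Fin N, ‖f fun j => EuclideanSpace.single (c j) (1 : ℝ)‖ := by
  refine ContinuousMultilinearMap.opNorm_le_bound (by positivity) fun m => ?_
  have hm : m = fun j => ∑ i, (m j i) • (EuclideanSpace.single i (1 : ℝ) : Conf N) := by
    funext j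
    have h := (EuclideanSpace.basisFun (Fin N) ℝ).sum_repr (m j)
    simpa using h.symm
  have h1 : f m = ∑ c : Fin n → Fin N, (∏ j, m j (c j)) •
      f fun j => EuclideanSpace.single (c j) (1 : ℝ) := by
    conv_lhs => rw [hm]
    refine (f.toMultilinearMap.map_sum
      (fun j i => (m j i) • (EuclideanSpace.single i (1 : ℝ) : Conf N))).trans ?_
    exact Finset.sum_congr rfl fun c _ => f.toMultilinearMap.map_smul_univ _ _
  rw [h1, Finset.sum_mul]
  refine (norm_sum_le _ _).trans (Finset.sum_le_sum fun c _ => ?_)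
  rw [norm_smul, norm_prod, mul_comm]
  refine mul_le_mul_of_nonneg_left ?_ (norm_nonneg _)
  exact Finset.prod_le_prod (fun _ _ => norm_nonneg _) fun j _ => PiLp.norm_apply_le (m j) (c j)

lemma exists_common_bound {ι : Type*} (s : Finset ι) {p : ι → Sch N → ℝ}
    (h : ∀ i ∈ s, ∃ γ, ∃ C : ℝ, 0 ≤ C ∧ ∀ ψ, p i ψ ≤ C * ‖vec (oscPow γ ψ)‖) :
    ∃ γ, ∃ C : ℝ, 0 ≤ C ∧ ∀ ψ, ∑ i ∈ s, p i ψ ≤ C * ‖vec (oscPow γ ψ)‖ := by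
  induction s using Finset.cons_induction with
  | empty => exact ⟨0, 0, le_rfl, fun ψ => by simp⟩
  | cons a s ha ih =>
    obtain ⟨γ, C, hC, h1⟩ := h a (by simp)
    obtain ⟨δ, D, hD, h2⟩ := ih fun i hi => h i (by simp [hi])
    refine ⟨γ + δ, C + D, by positivity, fun ψ => ?_⟩
    rw [Finset.sum_cons, add_mul]
    refine add_le_add ((h1 ψ).trans ?_) ((h2 ψ).trans ?_)
    · exact mul_le_mul_of_nonneg_left (norm_oscPow_mono le_self_add ψ) hC
    · exact mul_le_mul_of_nonneg_left (norm_oscPow_le_add γ δ ψ) hD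

/-- The weight ‖x‖^k is at most (1 + ‖x‖²)^k, which is multiplication by a polynomial in the Q_i.
The seminorm is thus bounded by finitely many sup norms of polynomial operators applied to ψ, where
the Sobolev inequality applies. -/
lemma exists_schwartz_seminorm_le (k n : ℕ) :
    ∃ γ, ∃ C : ℝ, 0 ≤ C ∧ ∀ ψ : Sch N,
      SchwartzMap.seminorm ℂ k n ψ ≤ C * ‖vec (oscPow γ ψ)‖ := by
  choose W hW h using fun c : Fin n → Fin N => exists_iteratedFDeriv_basis c
  have h2 : ∀ c : Fin n → Fin N, ∃ γ, ∃ C : ℝ, 0 ≤ C ∧ ∀ ψ x,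
      ‖(oneAddPosSq N ^ k * W c) ψ x‖ ≤ C * ‖vec (oscPow γ ψ)‖ := fun c =>
    exists_norm_polyOp_apply_le (mul_mem (pow_mem oneAddPosSq_mem k) (hW c))
  choose γ C hC h2 using h2
  obtain ⟨δ, D, hD, h3⟩ := exists_common_bound (N := N) Finset.univ
    (p := fun c ψ => C c * ‖vec (oscPow (γ c) ψ)‖) fun c _ => ⟨γ c, C c, hC c, fun ψ => le_rfl⟩
  refine ⟨δ, D, hD, fun ψ => SchwartzMap.seminorm_le_bound ℂ k n ψ (by positivity) fun x => ?_⟩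
  refine le_trans ?_ (h3 ψ)
  refine (mul_le_mul_of_nonneg_left (norm_multilinear_le_sum _) (by positivity)).trans ?_
  rw [Finset.mul_sum]
  refine Finset.sum_le_sum fun c _ => le_trans ?_ (h2 c ψ x)
  rw [h, mul_apply_eq_comp, oneAddPosSq_pow_apply, norm_mul, norm_pow, Complex.norm_real,
    Real.norm_of_nonneg (by positivity)]
  gcongr
  nlinarith [sq_nonneg (‖x‖ - 1)]

/-- The norms `ψ ↦ ‖(H + ½)^β ψ‖` on the Schwartz space. -/
def oscSeminorm (N : ℕ) : SeminormFamily ℂ (Sch N) (MultiIndex N) := fun β =>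
  (normSeminorm ℂ (Hilb N)).comp
    ((SchwartzMap.toLpCLM ℂ ℂ 2 volume ∘L oscPow β : Sch N →L[ℂ] Hilb N) : Sch N →ₗ[ℂ] Hilb N)

lemma oscSeminorm_apply (β : MultiIndex N) (ψ : Sch N) :
    oscSeminorm N β ψ = ‖vec (oscPow β ψ)‖ := rfl

lemma continuous_oscSeminorm (β : MultiIndex N) : Continuous (oscSeminorm N β) :=
  (continuous_vec.comp (oscPow β).continuous).norm

/-- The topology of the Schwartz space is defined by the norms `ψ ↦ ‖(H + ½)^β ψ‖`. -/
lemma withSeminorms_osc : WithSeminorms (oscSeminorm N) := by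
  have hS := schwartz_withSeminorms ℂ (Conf N) ℂ
  refine hS.congr (fun β => ?_) fun ⟨k, n⟩ => ?_
  · obtain ⟨s, C, -, h⟩ := Seminorm.bound_of_continuous hS _ (continuous_oscSeminorm β)
    exact ⟨s, C, h⟩
  · obtain ⟨γ, C, hC, h⟩ := exists_schwartz_seminorm_le (N := N) k n
    refine ⟨{γ}, ⟨C, hC⟩, fun ψ => ?_⟩
    rw [Finset.sup_singleton]
    exact h ψ

end Sobolev

/-! ### Hermite functions as joint eigenvectors. -/

section Hermite

lemma vec_zero : vec (0 : Sch N) = 0 := map_zero (SchwartzMap.toLpCLM ℂ ℂ 2 volume)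

/-- The ground state `exp (-‖x‖² / 2)` (unnormalised). -/
def groundState (N : ℕ) : Sch N := gaussianSchwartz (1 / 2) (by norm_num)

lemma groundState_apply (x : Conf N) :
    groundState N x = ((Real.exp (-(1 / 2 * ‖x‖ ^ 2)) : ℝ) : ℂ) := by
  rw [groundState, gaussianSchwartz_apply, Complex.ofReal_exp]

lemma annOp_groundState (i : Fin N) : annOp i (groundState N) = 0 := by
  ext q
  have h1 : ⇑(groundState N) = fun x => Complex.exp (((-(1 / 2 * ‖x‖ ^ 2) : ℝ)) : ℂ) := by
    ext x; rfl
  have h2 : HasFDerivAt (fun x : Conf N => -(1 / 2 * ‖x‖ ^ 2))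
      (-((1 / 2 : ℝ) • (2 • innerSL ℝ q))) q :=
    ((hasStrictFDerivAt_norm_sq q).hasFDerivAt.const_mul (1 / 2 : ℝ)).neg
  have h3 : HasFDerivAt (groundState N) (Complex.exp ((-(1 / 2 * ‖q‖ ^ 2) : ℝ) : ℂ) •
      (Complex.ofRealCLM ∘L (-((1 / 2 : ℝ) • (2 • innerSL ℝ q))))) q := by
    rw [h1]
    exact (Complex.ofRealCLM.hasFDerivAt.comp q h2).cexp
  rw [annOp, add_apply, smul_apply, add_apply, smul_apply, posOp_apply, momOp_apply, h3.fderiv, h1]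
  simp [EuclideanSpace.inner_single_right]
  linear_combination ((q i) * Complex.exp (-(2⁻¹ * ‖q‖ ^ 2)) : ℂ) * Complex.I_sq

/-- Unnormalised Hermite functions. -/
def hermRaw (α : MultiIndex N) : Sch N := tuplePow creOp α (groundState N)

lemma hermRaw_zero : hermRaw (0 : MultiIndex N) = groundState N := by
  rw [hermRaw, tuplePow_zero, one_apply_eq_self]

lemma hermRaw_add_single (i : Fin N) (α : MultiIndex N) :
    hermRaw (Pi.single i 1 + α) = creOp i (hermRaw α) := by
  rw [hermRaw, tuplePow_add creOp_mul_creOp, tuplePow_single, pow_one, mul_apply_eq_comp, hermRaw]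

lemma shiftedOsc_hermRaw (i : Fin N) (α : MultiIndex N) :
    shiftedOsc i (hermRaw α) = (α i + 1 : ℂ) • hermRaw α := by
  induction α using multiIndex_induction with
  | h0 =>
    rw [hermRaw_zero, shiftedOsc_eq, annOp_mul_creOp, if_pos rfl, smul_apply, add_apply,
      mul_apply_eq_comp, annOp_groundState, map_zero, zero_add, smul_apply, one_apply_eq_self]
    simp [smul_smul]
  | hs j α ih =>
    rw [hermRaw_add_single, ← mul_apply_eq_comp, shiftedOsc_mul_creOp, add_apply,
      mul_apply_eq_comp, ih, map_smul, smul_apply, ← add_smul]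
    congr 1
    rcases eq_or_ne i j with rfl | h
    · simp; ring
    · simp [h]

/-- Creation operators are injective because ‖a†φ‖² = ‖aφ‖² + 2‖φ‖². -/
lemma hermRaw_ne_zero (α : MultiIndex N) : hermRaw α ≠ 0 := by
  induction α using multiIndex_induction with
  | h0 =>
    intro h
    have h2 := groundState_apply (0 : Conf N)
    rw [← hermRaw_zero, h] at h2
    simp at h2
  | hs i α ih =>
    intro h
    rw [hermRaw_add_single] at h
    have h1 := norm_annOp_sq i (hermRaw α)
    rw [← norm_creOp_sq, h, vec_zero, norm_zero] at h1
    have h2 : vec (hermRaw α) = 0 := by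
      rw [← norm_eq_zero]
      refine pow_eq_zero_iff (two_ne_zero) |>.1 (le_antisymm ?_ (by positivity))
      nlinarith [sq_nonneg ‖vec (annOp i (hermRaw α))‖]
    exact ih (vec_injective (h2.trans vec_zero.symm))

/-- The Hermite functions, an orthonormal basis of `L²(ℝ^N)` of Schwartz functions. -/
def herm (α : MultiIndex N) : Sch N := ((‖vec (hermRaw α)‖⁻¹ : ℝ) : ℂ) • hermRaw α

lemma shiftedOsc_herm (i : Fin N) (α : MultiIndex N) :
    shiftedOsc i (herm α) = (α i + 1 : ℂ) • herm α := by
  rw [herm, map_smul, shiftedOsc_hermRaw, smul_comm]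

/-- The eigenvalue of `(H + ½)^β` on the Hermite function of index `α`. -/
def oscWeight (β α : MultiIndex N) : ℝ := ∏ i, ((α i : ℝ) + 1) ^ β i

lemma oscWeight_pos (β α : MultiIndex N) : 0 < oscWeight β α :=
  Finset.prod_pos fun i _ => by positivity

lemma oscWeight_add (β γ α : MultiIndex N) :
    oscWeight (β + γ) α = oscWeight β α * oscWeight γ α := by
  simp only [oscWeight, ← Finset.prod_mul_distrib, Pi.add_apply, pow_add]

lemma oscWeight_single (i : Fin N) (α : MultiIndex N) :
    oscWeight (Pi.single i 1) α = (α i : ℝ) + 1 := by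
  rw [oscWeight, Finset.prod_eq_single i]
  · simp
  · intro j _ hj; simp [hj]
  · simp

lemma oscPow_herm (β α : MultiIndex N) :
    oscPow β (herm α) = (oscWeight β α : ℂ) • herm α := by
  induction β using multiIndex_induction with
  | h0 => rw [oscPow_zero, one_apply_eq_self]; simp [oscWeight]
  | hs i β ih =>
    rw [oscPow_add_apply, ih, map_smul, oscPow_single, shiftedOsc_herm, smul_smul, oscWeight_add,
      oscWeight_single]
    push_cast
    rw [mul_comm]

lemma norm_vec_hermRaw_ne_zero (α : MultiIndex N) : ‖vec (hermRaw α)‖ ≠ 0 := by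
  rw [norm_ne_zero_iff]
  intro h
  exact hermRaw_ne_zero α
    (vec_injective (h.trans vec_zero.symm))

lemma orthonormal_herm : Orthonormal ℂ fun α : MultiIndex N => vec (herm α) := by
  refine ⟨fun α => ?_, fun α β hαβ => ?_⟩
  · change ‖vec (herm α)‖ = 1
    rw [herm, vec_smul, norm_smul, Complex.norm_real, norm_inv, norm_norm,
      inv_mul_cancel₀ (norm_vec_hermRaw_ne_zero α)]
  -- Distinct multi-indices differ in some mode `i`, and then the symmetric operator H_i + ½ has
  -- different eigenvalues on the two vectors.
  · obtain ⟨i, hi⟩ := Function.ne_iff.1 hαβ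
    have h := shiftedOsc_symmetric i (herm α) (herm β)
    rw [shiftedOsc_herm, shiftedOsc_herm, vec_smul, vec_smul, inner_smul_left, inner_smul_right]
      at h
    simp only [map_add, Complex.conj_natCast, map_one] at h
    have h2 : ((α i : ℂ) - β i) * inner ℂ (vec (herm α)) (vec (herm β)) = 0 := by
      linear_combination h
    exact (mul_eq_zero.1 h2).resolve_left (sub_ne_zero.2 (by exact_mod_cast hi))

/-- Creation operators raise the index, and annihilation operators can be commuted to the right
until they kill the ground state. In particular the span contains every polynomial times the
Gaussian, which is what totality requires. -/
lemma map_mem_span_hermRaw {W : Sch N →L[ℂ] Sch N} (hW : W ∈ polyOps N) {φ : Sch N}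
    (hφ : φ ∈ Submodule.span ℂ (Set.range (hermRaw (N := N)))) :
    W φ ∈ Submodule.span ℂ (Set.range (hermRaw (N := N))) := by
  set S := Submodule.span ℂ (Set.range (hermRaw (N := N))) with hS
  have hext : ∀ A : Sch N →L[ℂ] Sch N, (∀ α, A (hermRaw α) ∈ S) → ∀ φ ∈ S, A φ ∈ S := by
    intro A hA φ hφ
    have : S ≤ S.comap (A : Sch N →ₗ[ℂ] Sch N) := by
      conv_lhs => rw [hS]
      rw [Submodule.span_le]
      rintro _ ⟨α, rfl⟩
      exact hA α
    exact this hφ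
  have hmem : ∀ α, hermRaw α ∈ S := fun α => Submodule.subset_span ⟨α, rfl⟩
  have hcre : ∀ i, ∀ φ ∈ S, creOp i φ ∈ S := fun i => hext _ fun α => by
    rw [← hermRaw_add_single]; exact hmem _
  have hann : ∀ i, ∀ φ ∈ S, annOp i φ ∈ S := fun i => hext _ fun α => by
    induction α using multiIndex_induction with
    | h0 => rw [hermRaw_zero, annOp_groundState]; exact S.zero_mem
    | hs j α ih =>
      rw [hermRaw_add_single, ← mul_apply_eq_comp, annOp_mul_creOp, add_apply, mul_apply_eq_comp,
        smul_apply, one_apply_eq_self]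
      exact S.add_mem (hcre j _ ih) (S.smul_mem _ (hmem α))
  induction hW using Algebra.adjoin_induction generalizing φ with
  | mem x hx =>
    rcases hx with ⟨i, rfl⟩ | ⟨i, rfl⟩
    · rw [posOp_eq_ladder, smul_apply, add_apply]
      exact S.smul_mem _ (S.add_mem (hann i _ hφ) (hcre i _ hφ))
    · rw [momOp_eq_ladder, smul_apply, sub_apply]
      exact S.smul_mem _ (S.sub_mem (hann i _ hφ) (hcre i _ hφ))
  | algebraMap r =>
    rw [Algebra.algebraMap_eq_smul_one, smul_apply, one_apply_eq_self]
    exact S.smul_mem _ hφ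
  | add x y _ _ hx hy => rw [add_apply]; exact S.add_mem (hx hφ) (hy hφ)
  | mul x y _ _ hx hy => rw [mul_apply_eq_comp]; exact hx (hy hφ)

end Hermite

/-! ### Completeness of the Hermite functions in L² and in 𝔖. -/

section Totality

open FourierTransform

lemma coeFn_vec (ψ : Sch N) : vec ψ =ᵐ[volume] ψ := SchwartzMap.coeFn_toLp ψ 2 volume

lemma inner_vec_left (ψ : Sch N) (g : Hilb N) :
    inner ℂ (vec ψ) g = ∫ x, conj (ψ x) * g x := by
  rw [L2.inner_def]
  refine integral_congr_ae ?_
  filter_upwards [coeFn_vec ψ] with x hx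
  rw [hx, RCLike.inner_apply, mul_comm]

/-- Multiplication by the linear function `x ↦ ⟨x, ξ⟩`. -/
def linPosOp (ξ : Conf N) : Sch N →L[ℂ] Sch N := ∑ i, (ξ i : ℂ) • posOp i

lemma linPosOp_mem (ξ : Conf N) : linPosOp ξ ∈ polyOps N :=
  sum_mem fun i _ => Subalgebra.smul_mem _ (posOp_mem_polyOps i) _

lemma linPosOp_pow_apply (ξ : Conf N) (n : ℕ) (ψ : Sch N) (x : Conf N) :
    (linPosOp ξ ^ n) ψ x = ((inner ℝ x ξ : ℝ) : ℂ) ^ n * ψ x := by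
  induction n generalizing ψ with
  | zero => simp
  | succ n ih =>
    rw [pow_succ, mul_apply_eq_comp, ih, pow_succ (_ : ℂ), mul_assoc]
    congr 1
    rw [linPosOp, sum_apply, schwartz_sum_apply, PiLp.inner_apply]
    push_cast
    rw [Finset.sum_mul]
    refine Finset.sum_congr rfl fun i _ => ?_
    rw [Pi.smul_apply, smul_apply, posOp_apply]
    simp [mul_assoc]

/-- Expanding the Fourier kernel in its power series turns the integral into a sum of moments of g
against polynomials times the Gaussian, all of them zero. Dominated convergence justifies the
exchange. -/
lemma fourier_eq_zero_of_moments {g : Hilb N}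
    (hg : ∀ W ∈ polyOps N, inner ℂ (vec (W (groundState N))) g = 0) (ξ : Conf N) :
    𝓕 (fun x => groundState N x * g x) ξ = 0 := by
  have hgm : AEStronglyMeasurable g volume := Lp.aestronglyMeasurable g
  rw [Real.fourier_eq']
  set c : ℂ := -2 * Real.pi * Complex.I with hc
  set F : ℕ → Conf N → ℂ := fun n x =>
    (c * (inner ℝ x ξ : ℝ)) ^ n / n.factorial * (groundState N x * g x) with hF
  set bound : ℕ → Conf N → ℝ := fun n x =>
    (2 * Real.pi * |inner ℝ x ξ|) ^ n / n.factorial * ‖groundState N x * g x‖ with hbound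
  have hcn : ‖c‖ = 2 * Real.pi := by
    rw [hc]; simp [abs_of_pos Real.pi_pos]
  have htsum : ∀ x, ∑' n, bound n x
      = Real.exp (2 * Real.pi * |inner ℝ x ξ|) * ‖groundState N x * g x‖ := fun x => by
    rw [hbound, tsum_mul_right, Real.exp_eq_exp_ℝ, NormedSpace.exp_eq_tsum_div]
  have hint : Integrable (fun x => ∑' n, bound n x) volume := by
    simp_rw [htsum]
    -- Half of the Gaussian decay absorbs the exponential: 2π‖x‖‖ξ‖ − ‖x‖²/2 ≤ 4π²‖ξ‖² − ‖x‖²/4, by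
    -- expanding (‖x‖/2 − 2π‖ξ‖)² ≥ 0.
    set G2 : Sch N := gaussianSchwartz (1 / 4) (by norm_num)
    have h2 : Integrable (fun x => G2 x * g x) volume :=
      (G2.memLp 2 volume).integrable_mul (Lp.memLp g)
    refine (h2.norm.const_mul (Real.exp (4 * Real.pi ^ 2 * ‖ξ‖ ^ 2))).mono' ?_
      (Filter.Eventually.of_forall fun x => ?_)
    · refine AEStronglyMeasurable.mul (Continuous.aestronglyMeasurable (by fun_prop))
        (AEStronglyMeasurable.norm ?_)
      exact (groundState N).continuous.aestronglyMeasurable.mul hgm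
    · rw [norm_mul, norm_norm, norm_mul, norm_mul, ← mul_assoc, ← mul_assoc]
      refine mul_le_mul_of_nonneg_right ?_ (norm_nonneg _)
      rw [groundState_apply, gaussianSchwartz_apply, ← Complex.ofReal_exp, Complex.norm_real,
        Complex.norm_real]
      simp only [Real.norm_eq_abs, Real.abs_exp]
      rw [← Real.exp_add, ← Real.exp_add]
      refine Real.exp_le_exp.2 ?_
      have h3 : |inner ℝ x ξ| ≤ ‖x‖ * ‖ξ‖ := abs_real_inner_le_norm x ξ
      have h4 : 2 * Real.pi * |inner ℝ x ξ| ≤ 2 * Real.pi * (‖x‖ * ‖ξ‖) := by gcongr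
      nlinarith [sq_nonneg (‖x‖ / 2 - 2 * Real.pi * ‖ξ‖)]
  have key := hasSum_integral_of_dominated_convergence (μ := (volume : Measure (Conf N)))
    (F := F) (f := fun x => Complex.exp (c * (inner ℝ x ξ : ℝ)) * (groundState N x * g x)) bound
    (fun n => ?_) (fun n => Filter.Eventually.of_forall fun x => ?_)
    (Filter.Eventually.of_forall fun x => ?_) hint (Filter.Eventually.of_forall fun x => ?_)
  · have h0 : ∀ n, ∫ x, F n x = 0 := fun n => by
      have h1 := hg _ (pow_mem (linPosOp_mem ξ) n)
      rw [inner_vec_left] at h1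
      have h2 : ∀ x, F n x = c ^ n / n.factorial *
          (conj (((linPosOp ξ ^ n) (groundState N)) x) * g x) := fun x => by
        rw [linPosOp_pow_apply, groundState_apply, hF]
        simp only [map_mul, map_pow, Complex.conj_ofReal, mul_pow, groundState_apply]
        ring
      simp_rw [h2]
      rw [integral_const_mul, h1, mul_zero]
    have h1 := key.unique (by simp_rw [h0]; exact hasSum_zero)
    rw [← h1]
    refine integral_congr_ae (Filter.Eventually.of_forall fun x => ?_)
    simp only [smul_eq_mul, hc]
    push_cast
    ring_nf
  · refine AEStronglyMeasurable.mul (Continuous.aestronglyMeasurable ?_) ?_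
    · refine Continuous.div_const (Continuous.pow (continuous_const.mul ?_) n) _
      exact Complex.continuous_ofReal.comp (continuous_id.inner continuous_const)
    · exact (groundState N).continuous.aestronglyMeasurable.mul hgm
  · simp only [hF, hbound]
    rw [norm_mul, norm_div, norm_pow, norm_mul, hcn, Complex.norm_real, Real.norm_eq_abs]
    simp
  · exact (Real.summable_pow_div_factorial _).mul_right _
  · have h := NormedSpace.expSeries_div_hasSum_exp (c * (inner ℝ x ξ : ℝ))
    rw [← Complex.exp_eq_exp_ℂ] at h
    exact h.mul_right _

/-- The Gaussian times g is integrable with vanishing Fourier transform. Moving the transform onto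
test functions shows that it integrates to zero against all of them, so it vanishes almost
everywhere, and the Gaussian has no zeros. -/
lemma eq_zero_of_moments {g : Hilb N}
    (hg : ∀ W ∈ polyOps N, inner ℂ (vec (W (groundState N))) g = 0) : g = 0 := by
  set f : Conf N → ℂ := fun x => groundState N x * g x with hf
  have hfi : Integrable f volume :=
    ((groundState N).memLp 2 volume).integrable_mul (Lp.memLp g)
  have h1 : ∀ φ : Sch N, ∫ x, f x * φ x = 0 := fun φ => by
    have h := VectorFourier.integral_fourierIntegral_smul_eq_flip (L := innerₗ (Conf N))
      (μ := (volume : Measure (Conf N))) (ν := (volume : Measure (Conf N))) (f := f)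
      (g := (𝓕⁻ φ : Sch N)) Real.continuous_fourierChar continuous_inner hfi
      (𝓕⁻ φ : Sch N).integrable
    have h2 : ∀ ξ, VectorFourier.fourierIntegral Real.fourierChar volume (innerₗ (Conf N)) f ξ
        = 0 := fun ξ => fourier_eq_zero_of_moments hg ξ
    have h3 : VectorFourier.fourierIntegral Real.fourierChar volume (innerₗ (Conf N)).flip
        (𝓕⁻ φ : Sch N) = φ := by
      rw [flip_innerₗ]
      have : 𝓕 (𝓕⁻ φ) = φ := FourierTransform.fourier_fourierInv_eq φ
      exact congrArg DFunLike.coe this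
    simp only [h2, h3, smul_eq_mul, zero_mul, integral_zero] at h
    exact h.symm
  have h2 : ∀ᵐ x ∂(volume : Measure (Conf N)), f x = 0 := by
    refine ae_eq_zero_of_integral_contDiff_smul_eq_zero hfi.locallyIntegrable fun u hu hc => ?_
    have hg₁ : HasCompactSupport (Complex.ofRealCLM ∘ u) := hc.comp_left rfl
    have hg₂ : ContDiff ℝ (⊤ : ℕ∞) (Complex.ofRealCLM ∘ u) :=
      Complex.ofRealCLM.contDiff.comp hu
    rw [← h1 (hg₁.toSchwartzMap hg₂)]
    congr 1
    ext x
    simp [mul_comm]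
  rw [Lp.eq_zero_iff_ae_eq_zero]
  filter_upwards [h2] with x hx
  refine (mul_eq_zero.1 hx).resolve_left ?_
  rw [groundState_apply]
  exact_mod_cast (Real.exp_pos _).ne'

lemma span_herm_orthogonal :
    (Submodule.span ℂ (Set.range fun α : MultiIndex N => vec (herm α)))ᗮ = ⊥ := by
  rw [Submodule.eq_bot_iff]
  intro g hg
  refine eq_zero_of_moments fun W hW => ?_
  have h1 : ∀ α, inner ℂ (vec (hermRaw α)) g = 0 := fun α => by
    have h2 : hermRaw α = ((‖vec (hermRaw α)‖ : ℝ) : ℂ) • herm α := by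
      rw [herm, smul_smul, ← Complex.ofReal_mul, mul_inv_cancel₀ (norm_vec_hermRaw_ne_zero α),
        Complex.ofReal_one, one_smul]
    rw [h2, vec_smul, inner_smul_left,
      (Submodule.mem_orthogonal _ g).1 hg _ (Submodule.subset_span ⟨α, rfl⟩), mul_zero]
  have h3 : ∀ φ ∈ Submodule.span ℂ (Set.range (hermRaw (N := N))),
      inner ℂ (vec φ) g = 0 := fun φ hφ => by
    induction hφ using Submodule.span_induction with
    | mem x hx => obtain ⟨α, rfl⟩ := hx; exact h1 α
    | zero => rw [vec_zero, inner_zero_left]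
    | add x y _ _ hx hy => rw [vec_add, inner_add_left, hx, hy, add_zero]
    | smul c x _ hx => rw [vec_smul, inner_smul_left, hx, mul_zero]
  exact h3 _ (map_mem_span_hermRaw hW (Submodule.subset_span ⟨0, hermRaw_zero⟩))

/-- The Hilbert basis of Hermite functions. -/
def hermBasis (N : ℕ) : HilbertBasis (MultiIndex N) ℂ (Hilb N) :=
  HilbertBasis.mkOfOrthogonalEqBot orthonormal_herm span_herm_orthogonal

lemma hermBasis_apply (α : MultiIndex N) : hermBasis N α = vec (herm α) := by
  rw [hermBasis, HilbertBasis.coe_mkOfOrthogonalEqBot]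

/-- Hermite expansions converge in the Schwartz space. -/
lemma hasSum_herm (ψ : Sch N) :
    HasSum (fun α => inner ℂ (vec (herm α)) (vec ψ) • herm α) ψ := by
  refine (withSeminorms_osc.tendsto_nhds _ ψ).2 fun β ε hε => ?_
  -- By symmetry of (H + ½)^β, applying it termwise to the expansion of ψ gives the L² expansion of
  -- (H + ½)^β ψ. Convergence in the seminorm β is therefore plain L² convergence.
  have h := (hermBasis N).hasSum_repr (vec (oscPow β ψ))
  have h2 : ∀ α, (hermBasis N).repr (vec (oscPow β ψ)) α • hermBasis N α
      = vec (oscPow β (inner ℂ (vec (herm α)) (vec ψ) • herm α)) := fun α => by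
    rw [HilbertBasis.repr_apply_apply, hermBasis_apply, map_smul, oscPow_herm, vec_smul,
      vec_smul, smul_smul, ← oscPow_symmetric, oscPow_herm, vec_smul, inner_smul_left,
      Complex.conj_ofReal, mul_comm]
  simp_rw [h2] at h
  have h3 := (Metric.tendsto_nhds.1 h) ε hε
  filter_upwards [h3] with s hs
  rw [oscSeminorm_apply, map_sub, map_sum, vec_sub, vec_sum, ← dist_eq_norm]
  exact hs

end Totality

/-! ### Bijectivity of (H + ½)^β on 𝔖. -/

section Bijectivity

open Filter Topology

lemma shiftedOsc_injective (i : Fin N) : Function.Injective (shiftedOsc (N := N) i) := by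
  rw [injective_iff_map_eq_zero]
  intro φ hφ
  have h := norm_le_norm_shiftedOsc i φ
  rw [hφ, vec_zero, norm_zero, norm_le_zero_iff] at h
  exact vec_injective (h.trans vec_zero.symm)

lemma oscSeminorm_le_shiftedOsc (β : MultiIndex N) (i : Fin N) (φ : Sch N) :
    oscSeminorm N β φ ≤ oscSeminorm N β (shiftedOsc i φ) := by
  rw [oscSeminorm_apply, oscSeminorm_apply, ← oscPow_single, ← oscPow_add_apply]
  exact norm_oscPow_mono le_self_add φ

/-- The preimage is obtained by dividing the Hermite coefficients of f by the eigenvalues α_i + 1.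
As H_i + ½ does not decrease any of the oscillator norms, the new series inherits the Cauchy
property from the expansion of f, and 𝔖 is complete. -/
lemma shiftedOsc_surjective (i : Fin N) : Function.Surjective (shiftedOsc (N := N) i) := by
  intro f
  set c : MultiIndex N → ℂ := fun α => inner ℂ (vec (herm α)) (vec f) with hc
  set u : MultiIndex N → Sch N := fun α => ((α i + 1 : ℂ)⁻¹ * c α) • herm α with hu
  have hXu : ∀ α, shiftedOsc i (u α) = c α • herm α := fun α => by
    have : (α i + 1 : ℂ) ≠ 0 := by exact_mod_cast Nat.succ_ne_zero (α i)
    rw [hu, map_smul, shiftedOsc_herm, smul_smul, mul_right_comm, inv_mul_cancel₀ this, one_mul]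
  have hf := hasSum_herm f
  have hsum : Summable u := by
    rw [summable_iff_vanishing]
    intro e he
    obtain ⟨s, r, hr, hball⟩ := (withSeminorms_osc.mem_nhds_iff _ _).1 he
    have hr' : (s.sup (oscSeminorm N)).ball 0 r ∈ 𝓝 (0 : Sch N) :=
      (withSeminorms_osc.mem_nhds_iff _ _).2 ⟨s, r, hr, le_rfl⟩
    obtain ⟨t₀, ht₀⟩ := summable_iff_vanishing.1 hf.summable _ hr'
    refine ⟨t₀, fun t ht => hball ?_⟩
    have h1 := ht₀ t ht
    rw [Seminorm.mem_ball, sub_zero] at h1 ⊢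
    refine lt_of_le_of_lt ?_ h1
    refine Seminorm.finset_sup_apply_le (apply_nonneg _ _) fun β hβ => ?_
    refine (oscSeminorm_le_shiftedOsc β i _).trans ?_
    rw [map_sum]
    simp_rw [hXu]
    exact Seminorm.le_finset_sup_apply hβ
  refine ⟨∑' α, u α, ?_⟩
  have h2 := hsum.hasSum.mapL (shiftedOsc i)
  simp_rw [hXu] at h2
  exact h2.unique hf

lemma oscPow_bijective (β : MultiIndex N) : Function.Bijective (oscPow β) := by
  induction β using multiIndex_induction with
  | h0 => rw [oscPow_zero]; exact Function.bijective_id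
  | hs i β ih =>
    have h : ⇑(oscPow (Pi.single i 1 + β)) = shiftedOsc i ∘ oscPow β := by
      ext1 ψ; rw [oscPow_add_apply, oscPow_single]; rfl
    rw [h]
    exact Function.Bijective.comp ⟨shiftedOsc_injective i, shiftedOsc_surjective i⟩ ih

end Bijectivity

/-! ### Continuity of forms, oscillator bounds and matrix expansions. -/

section Forms

open Filter Topology

lemma summable_prod_apply {f : ℕ → ℝ} (hf0 : ∀ n, 0 ≤ f n) (hf : Summable f) (N : ℕ) :
    Summable fun n : Fin N → ℕ => ∏ i, f (n i) := by
  induction N with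
  | zero => exact Summable.of_finite
  | succ N ih =>
    rw [← (Fin.consEquiv fun _ : Fin (N + 1) => ℕ).summable_iff]
    refine (hf.mul_of_nonneg ih hf0 fun n => Finset.prod_nonneg fun i _ => hf0 _).congr ?_
    rintro ⟨a, n⟩
    simp [Fin.prod_univ_succ]

/-- The summable weights `∏ (α_i + 1)⁻²`. -/
def invWeight (α : MultiIndex N) : ℝ := (oscWeight (fun _ => 2) α)⁻¹

lemma invWeight_pos (α : MultiIndex N) : 0 < invWeight α := inv_pos.2 (oscWeight_pos _ _)

lemma summable_invWeight : Summable (invWeight (N := N)) := by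
  have h : Summable fun n : ℕ => (((n : ℝ) + 1) ^ 2)⁻¹ := by
    have h2 := (summable_nat_add_iff 1).2 (Real.summable_nat_pow_inv.2 (one_lt_two))
    simpa using h2
  refine (summable_prod_apply (fun n => by positivity) h N).congr fun α => ?_
  rw [invWeight, oscWeight, Finset.prod_inv_distrib]

lemma summable_invWeight_mul :
    Summable fun p : MultiIndex N × MultiIndex N => invWeight p.1 * invWeight p.2 :=
  summable_invWeight.mul_of_nonneg summable_invWeight (fun α => (invWeight_pos α).le)
    fun α => (invWeight_pos α).le

/-- Two extra powers of H + ½ in every mode turn growth of order `oscWeight β` into summable decay;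
every convergence argument for Hermite matrices below uses this trade. -/
lemma oscWeight_add_two (β α : MultiIndex N) :
    oscWeight β α * (oscWeight (β + fun _ => 2) α)⁻¹ = invWeight α := by
  have h1 := (oscWeight_pos β α).ne'
  rw [oscWeight_add, mul_inv, ← mul_assoc, mul_inv_cancel₀ h1, one_mul, invWeight]

lemma norm_vec_herm (α : MultiIndex N) : ‖vec (herm α)‖ = 1 := orthonormal_herm.1 α

lemma norm_oscPow_herm (β α : MultiIndex N) : ‖vec (oscPow β (herm α))‖ = oscWeight β α := by
  rw [oscPow_herm, vec_smul, norm_smul, norm_vec_herm, mul_one, Complex.norm_real,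
    Real.norm_of_nonneg (oscWeight_pos _ _).le]

lemma inner_herm_oscPow (β α : MultiIndex N) (ψ : Sch N) :
    inner ℂ (vec (herm α)) (vec (oscPow β ψ))
      = (oscWeight β α : ℂ) * inner ℂ (vec (herm α)) (vec ψ) := by
  rw [← oscPow_symmetric, oscPow_herm, vec_smul, inner_smul_left, Complex.conj_ofReal]

lemma inner_oscPow_herm (β α : MultiIndex N) (ψ : Sch N) :
    inner ℂ (vec (oscPow β ψ)) (vec (herm α))
      = (oscWeight β α : ℂ) * inner ℂ (vec ψ) (vec (herm α)) := by
  rw [← inner_conj_symm, inner_herm_oscPow, map_mul, Complex.conj_ofReal, inner_conj_symm]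

lemma norm_inner_herm_le (β α : MultiIndex N) (ψ : Sch N) :
    ‖inner ℂ (vec (herm α)) (vec ψ)‖ ≤ (oscWeight β α)⁻¹ * ‖vec (oscPow β ψ)‖ := by
  have h := norm_inner_le_norm (𝕜 := ℂ) (vec (herm α)) (vec (oscPow β ψ))
  rw [inner_herm_oscPow, norm_mul, norm_vec_herm, one_mul, Complex.norm_real,
    Real.norm_of_nonneg (oscWeight_pos _ _).le] at h
  rwa [← div_eq_inv_mul, le_div_iff₀ (oscWeight_pos _ _), mul_comm]

lemma ne_zero_norm_oscPow {ψ : Sch N} (hψ : ψ ≠ 0) (β : MultiIndex N) :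
    0 < ‖vec (oscPow β ψ)‖ := by
  refine lt_of_lt_of_le (norm_pos_iff.2 fun h => hψ ?_) (norm_le_norm_oscPow β ψ)
  exact vec_injective (h.trans vec_zero.symm)

lemma exists_oscBall_subset {U : Set (Sch N)} (hU : U ∈ 𝓝 (0 : Sch N)) :
    ∃ β, ∃ r : ℝ, 0 < r ∧ ∀ ψ, ‖vec (oscPow β ψ)‖ < r → ψ ∈ U := by
  obtain ⟨s, r, hr, h⟩ := (withSeminorms_osc.mem_nhds_iff _ _).1 hU
  -- The norms increase with β, so the sum of finitely many indices dominates each of them.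
  refine ⟨∑ β ∈ s, β, r, hr, fun ψ hψ => h ?_⟩
  rw [Seminorm.mem_ball, sub_zero]
  refine lt_of_le_of_lt (Seminorm.finset_sup_apply_le (norm_nonneg _) fun β hβ => ?_) hψ
  exact norm_oscPow_mono (Finset.single_le_sum (f := fun β : MultiIndex N => β)
    (fun _ _ => zero_le) hβ) ψ

lemma JointlyContinuous.exists_bound {B : SesqForm N} (hB : JointlyContinuous B) :
    ∃ β β' : MultiIndex N, ∃ C : ℝ, 0 < C ∧ ∀ ψ ψ' : Sch N,
      ‖B ψ ψ'‖ ≤ C * ‖vec (oscPow β ψ)‖ * ‖vec (oscPow β' ψ')‖ := by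
  have h0 : {p : Sch N × Sch N | ‖B p.1 p.2‖ < 1} ∈ 𝓝 ((0, 0) : Sch N × Sch N) := by
    refine (hB.norm.tendsto (0, 0)).eventually_lt_const ?_
    simp
  rw [nhds_prod_eq, mem_prod_iff] at h0
  obtain ⟨U, hU, V, hV, hUV⟩ := h0
  obtain ⟨β, r, hr, h1⟩ := exists_oscBall_subset hU
  obtain ⟨β', r', hr', h2⟩ := exists_oscBall_subset hV
  -- Both arguments are rescaled to norm r/2 and r'/2, strictly inside the balls where |B| < 1; the
  -- two halves account for the 4.
  refine ⟨β, β', 4 / (r * r'), by positivity, fun ψ ψ' => ?_⟩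
  rcases eq_or_ne ψ 0 with rfl | hψ
  · simp [vec_zero]
  rcases eq_or_ne ψ' 0 with rfl | hψ'
  · simp [vec_zero]
  have ha := ne_zero_norm_oscPow hψ β
  have ha' := ne_zero_norm_oscPow hψ' β'
  set a := ‖vec (oscPow β ψ)‖ with haa
  set a' := ‖vec (oscPow β' ψ')‖ with haa'
  set t : ℂ := ((r / (2 * a) : ℝ) : ℂ) with ht
  set t' : ℂ := ((r' / (2 * a') : ℝ) : ℂ) with ht'
  have htn : ‖t‖ = r / (2 * a) := by
    rw [ht, Complex.norm_real, Real.norm_of_nonneg (by positivity)]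
  have htn' : ‖t'‖ = r' / (2 * a') := by
    rw [ht', Complex.norm_real, Real.norm_of_nonneg (by positivity)]
  have h3 : t • ψ ∈ U := h1 _ (by
    rw [map_smul, vec_smul, norm_smul, htn, ← haa, div_mul_eq_mul_div, div_lt_iff₀ (by positivity)]
    nlinarith)
  have h4 : t' • ψ' ∈ V := h2 _ (by
    rw [map_smul, vec_smul, norm_smul, htn', ← haa', div_mul_eq_mul_div,
      div_lt_iff₀ (by positivity)]
    nlinarith)
  have h5 : ‖B (t • ψ) (t' • ψ')‖ < 1 := hUV (Set.mk_mem_prod h3 h4)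
  rw [(B (t • ψ)).map_smul, B.map_smulₛₗ, LinearMap.smul_apply, smul_smul, norm_smul, norm_mul,
    RCLike.norm_conj, htn, htn'] at h5
  have h6 : r' / (2 * a') * (r / (2 * a)) = (4 / (r * r') * a * a')⁻¹ := by
    field_simp
    norm_num
  rw [h6, inv_mul_lt_iff₀ (by positivity), mul_one] at h5
  exact h5.le

/-- 𝔖 is first countable, so sequences suffice. Along a convergent sequence ψ_n → ψ the functionals
B(ψ_n, ·) converge pointwise, hence are equicontinuous by Banach–Steinhaus, and B(ψ_n, φ_n) = B(ψ_n,
φ_n − φ) + B(ψ_n, φ). -/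
lemma SeparatelyContinuous.jointlyContinuous {B : SesqForm N} (hB : SeparatelyContinuous B) :
    JointlyContinuous B := by
  refine continuous_iff_seqContinuous.2 fun p p₀ hp => ?_
  have hp1 : Tendsto (fun n => (p n).1) atTop (𝓝 p₀.1) := (continuous_fst.tendsto _).comp hp
  have hp2 : Tendsto (fun n => (p n).2) atTop (𝓝 p₀.2) := (continuous_snd.tendsto _).comp hp
  let L : ℕ → Sch N →L[ℂ] ℂ := fun n => ⟨B (p n).1, hB.2 (p n).1⟩
  have hlim : ∀ φ, Tendsto (fun n => B (p n).1 φ) atTop (𝓝 (B p₀.1 φ)) := fun φ =>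
    ((hB.1 φ).tendsto _).comp hp1
  have heq : UniformEquicontinuous (fun n => ⇑(L n)) := by
    refine (norm_withSeminorms ℂ ℂ).banach_steinhaus (𝓕 := L) fun _ φ => ?_
    exact (hlim φ).norm.bddAbove_range
  have h1 : Tendsto (fun n => B (p n).1 ((p n).2 - p₀.2)) atTop (𝓝 0) := by
    rw [Metric.tendsto_nhds]
    intro ε hε
    have h2 := Metric.equicontinuousAt_iff_right.1 (heq.equicontinuous 0) ε hε
    have h3 : Tendsto (fun n => (p n).2 - p₀.2) atTop (𝓝 0) := by
      simpa using hp2.sub_const p₀.2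
    filter_upwards [h3.eventually h2] with n hn
    have h4 := hn n
    rw [map_zero, dist_comm] at h4
    exact h4
  have h5 := h1.add (hlim p₀.2)
  rw [zero_add] at h5
  refine h5.congr fun n => ?_
  rw [← map_add, sub_add_cancel]
  rfl

lemma JointlyContinuous.separatelyContinuous {B : SesqForm N} (hB : JointlyContinuous B) :
    SeparatelyContinuous B :=
  ⟨fun _ => hB.comp (continuous_id.prodMk continuous_const),
    fun _ => hB.comp (continuous_const.prodMk continuous_id)⟩

lemma oscPow_oscInvPow (β : MultiIndex N) (ψ : Sch N) : oscPow β (oscInvPow β ψ) = ψ :=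
  Function.rightInverse_invFun (oscPow_bijective β).2 ψ

lemma oscInvPow_oscPow (β : MultiIndex N) (ψ : Sch N) : oscInvPow β (oscPow β ψ) = ψ :=
  Function.leftInverse_invFun (oscPow_bijective β).1 ψ

lemma JointlyContinuous.oscBounded {B : SesqForm N} (hB : JointlyContinuous B) :
    OscBounded B := by
  obtain ⟨β, β', C, hC, h⟩ := hB.exists_bound
  refine ⟨β, β', C, hC, fun ψ ψ' => ?_⟩
  have h1 := h (oscInvPow β ψ) (oscInvPow β' ψ')
  rwa [oscPow_oscInvPow, oscPow_oscInvPow] at h1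

/-- The ring homomorphism σ is left general so that the antilinear and the linear slot are treated
together. -/
lemma continuous_of_bound {σ : ℂ →+* ℂ} [RingHomIsometric σ] (f : Sch N →ₛₗ[σ] ℂ)
    (β : MultiIndex N) (C : ℝ) (h : ∀ ψ, ‖f ψ‖ ≤ C * ‖vec (oscPow β ψ)‖) : Continuous f := by
  refine continuous_of_continuousAt_zero f.toAddMonoidHom ?_
  have h1 : Tendsto (fun ψ : Sch N => C * ‖vec (oscPow β ψ)‖) (𝓝 0) (𝓝 0) := by
    have := ((continuous_oscSeminorm β).tendsto 0).const_mul C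
    rw [map_zero, mul_zero] at this
    exact this
  have h2 := squeeze_zero_norm h h1
  change Tendsto f (𝓝 0) (𝓝 (f 0))
  rwa [map_zero]

lemma separatelyContinuous_of_bound {B : SesqForm N} {β β' : MultiIndex N} {C : ℝ}
    (h : ∀ ψ ψ' : Sch N, ‖B ψ ψ'‖ ≤ C * ‖vec (oscPow β ψ)‖ * ‖vec (oscPow β' ψ')‖) :
    SeparatelyContinuous B := by
  refine ⟨fun ψ' => continuous_of_bound (B.flip ψ') β (C * ‖vec (oscPow β' ψ')‖) fun ψ => ?_,
    fun ψ => continuous_of_bound (B ψ) β' (C * ‖vec (oscPow β ψ)‖) fun ψ' => h ψ ψ'⟩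
  rw [mul_right_comm]
  exact h ψ ψ'

lemma OscBounded.separatelyContinuous {B : SesqForm N} (hB : OscBounded B) :
    SeparatelyContinuous B := by
  obtain ⟨β, β', C, -, h⟩ := hB
  refine separatelyContinuous_of_bound (β := β) (β' := β') (C := C) fun ψ ψ' => ?_
  have h1 := h (oscPow β ψ) (oscPow β' ψ')
  rwa [oscInvPow_oscPow, oscInvPow_oscPow] at h1

lemma HilbertSchmidtRegular.jointlyContinuous {B : SesqForm N} (hB : HilbertSchmidtRegular B) :
    JointlyContinuous B := by
  obtain ⟨A, -, PL, -, PR, -, PR', -, h⟩ := hB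
  have h2 : (fun p : Sch N × Sch N => B p.1 p.2)
      = fun p => inner ℂ (vec (PR' p.1)) (A (vec (PL p.2))) := by
    ext p; exact h _ _
  rw [JointlyContinuous, h2]
  exact (continuous_vec.comp (PR'.continuous.comp continuous_fst)).inner
    (A.continuous.comp (continuous_vec.comp (PL.continuous.comp continuous_snd)))

/-- The expansion of a form in its matrix elements between Hermite functions. -/
lemma JointlyContinuous.hasSum_herm {B : SesqForm N} (hB : JointlyContinuous B) (ψ ψ' : Sch N) :
    HasSum (fun p : MultiIndex N × MultiIndex N =>
      inner ℂ (vec ψ) (vec (herm p.1)) * inner ℂ (vec (herm p.2)) (vec ψ') *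
        B (herm p.1) (herm p.2)) (B ψ ψ') := by
  obtain ⟨β, β', C, hC, h⟩ := hB.exists_bound
  have hsum : Summable (fun p : MultiIndex N × MultiIndex N =>
      inner ℂ (vec ψ) (vec (herm p.1)) * inner ℂ (vec (herm p.2)) (vec ψ') *
        B (herm p.1) (herm p.2)) := by
    -- Absolute summability of the double series comes first; its value is then identified by
    -- summing one slot at a time, where separate continuity of `B` suffices.
    refine Summable.of_norm_bounded (summable_invWeight_mul.mul_left
      (C * ‖vec (oscPow (β + fun _ => 2) ψ)‖ * ‖vec (oscPow (β' + fun _ => 2) ψ')‖)) ?_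
    rintro ⟨m, n⟩
    have h1 := h (herm m) (herm n)
    rw [norm_oscPow_herm, norm_oscPow_herm] at h1
    have h2 := norm_inner_herm_le (β + fun _ => 2) m ψ
    have h3 := norm_inner_herm_le (β' + fun _ => 2) n ψ'
    rw [norm_inner_symm] at h2
    rw [norm_mul, norm_mul]
    refine (mul_le_mul (mul_le_mul h2 h3 (norm_nonneg _) (mul_nonneg
      (inv_pos.2 (oscWeight_pos _ _)).le (norm_nonneg _))) h1 (norm_nonneg _)
      (mul_nonneg (mul_nonneg (inv_pos.2 (oscWeight_pos _ _)).le (norm_nonneg _))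
        (mul_nonneg (inv_pos.2 (oscWeight_pos _ _)).le (norm_nonneg _)))).trans_eq ?_
    rw [← oscWeight_add_two β, ← oscWeight_add_two β']
    ring
  have h1 : ∀ m, HasSum (fun n => inner ℂ (vec ψ) (vec (herm m)) *
      inner ℂ (vec (herm n)) (vec ψ') * B (herm m) (herm n))
      (inner ℂ (vec ψ) (vec (herm m)) * B (herm m) ψ') := fun m => by
    have h2 := (QHarm.hasSum_herm ψ').map (B (herm m)) (hB.separatelyContinuous.2 (herm m))
    refine (h2.mul_left (inner ℂ (vec ψ) (vec (herm m)))).congr_fun fun n => ?_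
    simp [mul_assoc]
  have h2 : HasSum (fun m => inner ℂ (vec ψ) (vec (herm m)) * B (herm m) ψ') (B ψ ψ') := by
    have h3 := (QHarm.hasSum_herm ψ).map (B.flip ψ') (hB.separatelyContinuous.1 ψ')
    refine h3.congr_fun fun m => ?_
    simp
  rw [← (hsum.hasSum.prod_fiberwise h1).unique h2]
  exact hsum.hasSum

end Forms

/-! ### Hilbert–Schmidt regularisation and the equivalence of the four conditions. -/

section HilbertSchmidt

open Filter Topology

lemma one_le_oscWeight (β α : MultiIndex N) : 1 ≤ oscWeight β α := by
  rw [← norm_oscPow_herm, ← norm_vec_herm α]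
  exact norm_le_norm_oscPow β _

lemma invWeight_le_one (α : MultiIndex N) : invWeight α ≤ 1 :=
  inv_le_one_of_one_le₀ (one_le_oscWeight _ _)

lemma hasSum_mul_column {ι : Type*} [DecidableEq ι] {f : ι → ℝ} (hf0 : ∀ i, 0 ≤ f i)
    (hf : Summable f) (k : ι) {c : ℝ} (hc : 0 ≤ c) :
    HasSum (fun p : ι × ι => f p.1 * if p.2 = k then c else 0) ((∑' i, f i) * c) := by
  have h1 : HasSum (fun n : ι => if n = k then c else 0) c := hasSum_ite_eq k c
  have h0 : ∀ n : ι, 0 ≤ if n = k then c else 0 := fun n => by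
    split_ifs
    exacts [hc, le_rfl]
  exact hf.hasSum.mul h1 (hf.mul_of_nonneg h1.summable hf0 h0)

/-- An operator whose matrix elements between Hermite functions decay like `invWeight` is
Hilbert–Schmidt. -/
lemma exists_hilbertSchmidt_of_matrix (a : MultiIndex N × MultiIndex N → ℂ) (C : ℝ)
    (ha : ∀ p, ‖a p‖ ≤ C * (invWeight p.1 * invWeight p.2)) :
    ∃ A : Hilb N →L[ℂ] Hilb N, IsHilbertSchmidt A ∧ ∀ x y,
      HasSum (fun p : MultiIndex N × MultiIndex N =>
        a p * (inner ℂ (vec (herm p.2)) y * inner ℂ x (vec (herm p.1)))) (inner ℂ x (A y)) := by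
  set R : MultiIndex N × MultiIndex N → Hilb N →L[ℂ] Hilb N := fun p =>
    a p • InnerProductSpace.rankOne ℂ (vec (herm p.1)) (vec (herm p.2)) with hR
  -- The rank-one pieces have operator norm |a_p|, so the series converges absolutely in operator
  -- norm.
  have hsum : Summable R := by
    refine Summable.of_norm_bounded (summable_invWeight_mul.mul_left C) fun p => ?_
    rw [hR, norm_smul, InnerProductSpace.norm_rankOne, norm_vec_herm, norm_vec_herm, mul_one,
      mul_one]
    exact ha p
  have hC : 0 ≤ C := by
    have h := (norm_nonneg _).trans (ha (0, 0))
    exact nonneg_of_mul_nonneg_left h (mul_pos (invWeight_pos _) (invWeight_pos _))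
  have happ : ∀ y, HasSum (fun p => R p y) ((∑' p, R p) y) := fun y =>
    hsum.hasSum.mapL (ContinuousLinearMap.apply ℂ (Hilb N) y)
  refine ⟨∑' p, R p, ⟨MultiIndex N, hermBasis N, ?_⟩, fun x y => ?_⟩
  · set S := ∑' α : MultiIndex N, invWeight α with hS
    have hS0 : 0 ≤ S := tsum_nonneg fun α => (invWeight_pos α).le
    -- Only the k-th column of the matrix contributes. The bounds are square summable because the
    -- weights are summable and at most 1.
    have hbd : ∀ k, ‖(∑' p, R p) (hermBasis N k)‖ ≤ C * (S * invWeight k) := fun k => by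
      have h2 := (hasSum_mul_column (fun α => (invWeight_pos α).le) summable_invWeight k
        (invWeight_pos k).le).mul_left C
      rw [← (happ (hermBasis N k)).tsum_eq]
      refine tsum_of_norm_bounded h2 fun p => ?_
      rw [hermBasis_apply, hR, smul_apply, InnerProductSpace.rankOne_apply,
        orthonormal_iff_ite.1 orthonormal_herm]
      split_ifs with h
      · rw [one_smul, norm_smul, norm_vec_herm, mul_one, ← h]
        exact ha p
      · simp
    refine Summable.of_nonneg_of_le (fun k => by positivity) (fun k => ?_)
      (summable_invWeight.mul_left ((C * S) ^ 2))
    refine (pow_le_pow_left₀ (norm_nonneg _) (hbd k) 2).trans ?_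
    rw [← mul_assoc, mul_pow]
    refine mul_le_mul_of_nonneg_left ?_ (by positivity)
    rw [pow_two]
    exact mul_le_of_le_one_left (invWeight_pos k).le (invWeight_le_one k)
  · refine ((happ y).mapL (innerSL ℂ x)).congr_fun fun p => ?_
    simp only [hR, smul_apply, InnerProductSpace.rankOne_apply, innerSL_apply_apply,
      inner_smul_right]

/-- `A` is the matrix of B((H + ½)^{-γ} ·, (H + ½)^{-γ'} ·), where γ, γ' exceed the continuity
indices by 2 in each mode. The positive powers that undo this are polynomial and symmetric, so they
serve as P_L and as P_R = P_R^*. -/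
lemma JointlyContinuous.hilbertSchmidtRegular {B : SesqForm N} (hB : JointlyContinuous B) :
    HilbertSchmidtRegular B := by
  obtain ⟨β, β', C, hC, h⟩ := hB.exists_bound
  set γ : MultiIndex N := β + fun _ => 2 with hγ
  set γ' : MultiIndex N := β' + fun _ => 2 with hγ'
  obtain ⟨A, hA, hAB⟩ := exists_hilbertSchmidt_of_matrix
    (fun p => ((oscWeight γ p.1)⁻¹ : ℝ) * ((oscWeight γ' p.2)⁻¹ : ℝ) * B (herm p.1) (herm p.2))
    C (fun p => by
      have h1 := h (herm p.1) (herm p.2)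
      rw [norm_oscPow_herm, norm_oscPow_herm] at h1
      rw [norm_mul, norm_mul, Complex.norm_real, Complex.norm_real,
        Real.norm_of_nonneg (inv_pos.2 (oscWeight_pos _ _)).le,
        Real.norm_of_nonneg (inv_pos.2 (oscWeight_pos _ _)).le]
      refine (mul_le_mul_of_nonneg_left h1 (mul_nonneg (inv_pos.2 (oscWeight_pos _ _)).le
        (inv_pos.2 (oscWeight_pos _ _)).le)).trans_eq ?_
      rw [← oscWeight_add_two β, ← oscWeight_add_two β']
      ring)
  refine ⟨A, hA, oscPow γ', oscPow_mem_polyOps _, oscPow γ, oscPow_mem_polyOps _, oscPow γ,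
    oscPow_symmetric _, fun ψ ψ' => ?_⟩
  refine (hB.hasSum_herm ψ ψ').unique ((hAB _ _).congr_fun fun p => ?_)
  have h1 : (oscWeight γ p.1 : ℂ) ≠ 0 := by exact_mod_cast (oscWeight_pos _ _).ne'
  have h2 : (oscWeight γ' p.2 : ℂ) ≠ 0 := by exact_mod_cast (oscWeight_pos _ _).ne'
  rw [inner_herm_oscPow, inner_oscPow_herm]
  push_cast
  field_simp

lemma tfae_regular (B : SesqForm N) :
    List.TFAE [SeparatelyContinuous B, JointlyContinuous B, OscBounded B,
      HilbertSchmidtRegular B] := by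
  tfae_have 1 → 2 := SeparatelyContinuous.jointlyContinuous
  tfae_have 2 → 3 := JointlyContinuous.oscBounded
  tfae_have 3 → 1 := OscBounded.separatelyContinuous
  tfae_have 2 → 4 := JointlyContinuous.hilbertSchmidtRegular
  tfae_have 4 → 2 := HilbertSchmidtRegular.jointlyContinuous
  tfae_finish

end HilbertSchmidt

/-! ### Forms and continuous maps from 𝔖 to 𝔖'. -/

section Distributions

lemma conjSch_conjSch (ψ : Sch N) : conjSch (conjSch ψ) = ψ := by
  ext q
  rw [conjSch_apply, conjSch_apply, Complex.conj_conj]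

lemma conjSch_add (φ ψ : Sch N) : conjSch (φ + ψ) = conjSch φ + conjSch ψ := by
  ext q
  simp [conjSch_apply]

lemma conjSch_smul (c : ℂ) (ψ : Sch N) : conjSch (c • ψ) = conj c • conjSch ψ := by
  ext q
  simp [conjSch_apply]

lemma continuous_conjSch : Continuous (conjSch : Sch N → Sch N) :=
  (SchwartzMap.postcompCLM (Complex.conjCLE : ℂ →L[ℝ] ℂ)).continuous

/-- The form `(ψ', ψ) ↦ (F ψ)(conj ψ')` of a continuous linear map `F : 𝔖 → 𝔖'`. -/
def formOfMap (F : Sch N →L[ℂ] 𝓢'(Conf N, ℂ)) : SesqForm N :=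
  LinearMap.mk₂'ₛₗ (starRingEnd ℂ) (RingHom.id ℂ) (fun ψ' ψ => F ψ (conjSch ψ'))
    (fun φ ψ χ => by rw [conjSch_add, map_add])
    (fun c φ χ => by rw [conjSch_smul, map_smul])
    (fun φ χ χ' => by rw [map_add]; rfl)
    (fun c φ χ => by rw [map_smul]; rfl)

lemma formOfMap_apply (F : Sch N →L[ℂ] 𝓢'(Conf N, ℂ)) (ψ' ψ : Sch N) :
    formOfMap F ψ' ψ = F ψ (conjSch ψ') := rfl

/-- Continuity into the weak-* topology only controls each evaluation, that is, separate continuity;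
the joint statement comes from Banach–Steinhaus. -/
lemma formOfMap_jointlyContinuous (F : Sch N →L[ℂ] 𝓢'(Conf N, ℂ)) :
    JointlyContinuous (formOfMap F) := by
  refine SeparatelyContinuous.jointlyContinuous ⟨fun ψ => ?_, fun ψ' => ?_⟩
  · exact (F ψ).continuous.comp continuous_conjSch
  · exact (PointwiseConvergenceCLM.evalCLM (RingHom.id ℂ) ℂ (conjSch ψ')).continuous.comp
      F.continuous

/-- The continuous linear map `𝔖 → 𝔖'` of a continuous form. -/
def mapOfForm (B : SesqForm N) (hB : SeparatelyContinuous B) :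
    Sch N →L[ℂ] 𝓢'(Conf N, ℂ) where
  toFun ψ := (({ toFun := fun χ => B (conjSch χ) ψ
                 map_add' := fun χ χ' => by rw [conjSch_add, map_add]; rfl
                 map_smul' := fun c χ => by
                  rw [conjSch_smul, map_smulₛₗ, Complex.conj_conj]; rfl
                 cont := (hB.1 ψ).comp continuous_conjSch } : Sch N →L[ℂ] ℂ))
  map_add' φ ψ := by ext χ; exact map_add (B (conjSch χ)) φ ψ
  map_smul' c ψ := by ext χ; exact map_smul (B (conjSch χ)) c ψ
  cont := PointwiseConvergenceCLM.continuous_of_continuous_eval fun χ => hB.2 (conjSch χ)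

lemma mapOfForm_apply (B : SesqForm N) (hB : SeparatelyContinuous B) (ψ χ : Sch N) :
    mapOfForm B hB ψ χ = B (conjSch χ) ψ := rfl

/-- Continuous sesquilinear forms correspond to continuous linear maps `𝔖 → 𝔖'`. -/
def formEquivMap (N : ℕ) :
    {B : SesqForm N // JointlyContinuous B} ≃ (Sch N →L[ℂ] 𝓢'(Conf N, ℂ)) where
  toFun B := mapOfForm B.1 B.2.separatelyContinuous
  invFun F := ⟨formOfMap F, formOfMap_jointlyContinuous F⟩
  left_inv B := by
    ext ψ' ψ
    change mapOfForm B.1 B.2.separatelyContinuous ψ (conjSch ψ') = _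
    rw [mapOfForm_apply, conjSch_conjSch]
  right_inv F := by
    ext ψ χ
    change formOfMap F (conjSch χ) ψ = _
    rw [formOfMap_apply, conjSch_conjSch]

end Distributions

/-! ### Normal ordering of polynomials in Q and P. -/

section NormalOrdering

lemma momOp_mul_momPos (i : Fin N) (β α : MultiIndex N) :
    momOp i * momPos β α = momPos (Pi.single i 1 + β) α := by
  rw [momPos, momPos, tuplePow_add momOp_mul_momOp, tuplePow_single, pow_one, mul_assoc]

/-- Q_i is moved to the right through P^β one factor at a time; each commutator is a scalar and
leaves a shorter normally ordered word. -/
lemma posOp_mul_momPos_mem (i : Fin N) (β α : MultiIndex N) :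
    posOp i * momPos β α ∈ Submodule.span ℂ
      (Set.range fun p : MultiIndex N × MultiIndex N => momPos (N := N) p.1 p.2) := by
  set S := Submodule.span ℂ
    (Set.range fun p : MultiIndex N × MultiIndex N => momPos (N := N) p.1 p.2) with hS
  have hmem : ∀ β α, momPos β α ∈ S := fun β α => Submodule.subset_span ⟨(β, α), rfl⟩
  have hmom : ∀ j, ∀ V ∈ S, momOp j * V ∈ S := fun j V hV => by
    induction hV using Submodule.span_induction with
    | mem x hx => obtain ⟨p, rfl⟩ := hx; simp only [momOp_mul_momPos]; exact hmem _ _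
    | zero => rw [mul_zero]; exact S.zero_mem
    | add x y _ _ hx hy => rw [mul_add]; exact S.add_mem hx hy
    | smul c x _ hx => rw [mul_smul_comm]; exact S.smul_mem _ hx
  induction β using multiIndex_induction with
  | h0 =>
    have h : posOp i * momPos 0 α = momPos 0 (Pi.single i 1 + α) := by
      rw [momPos, momPos, tuplePow_zero, one_mul, one_mul, tuplePow_add posOp_mul_posOp,
        tuplePow_single, pow_one]
    rw [h]
    exact hmem _ _
  | hs j β ih =>
    rw [← momOp_mul_momPos, ← mul_assoc, posOp_mul_momOp, add_mul, mul_assoc, smul_mul_assoc,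
      one_mul]
    exact S.add_mem (hmom j _ ih) (S.smul_mem _ (hmem _ _))

/-- Normal ordering: every polynomial in the `Q_i`, `P_i` is a linear combination of the
`P^β Q^α`. -/
lemma polyOps_subset_span {W : Sch N →L[ℂ] Sch N} (hW : W ∈ polyOps N) :
    W ∈ Submodule.span ℂ
      (Set.range fun p : MultiIndex N × MultiIndex N => momPos (N := N) p.1 p.2) := by
  set S := Submodule.span ℂ
    (Set.range fun p : MultiIndex N × MultiIndex N => momPos (N := N) p.1 p.2) with hS
  have hmem : ∀ β α, momPos β α ∈ S := fun β α => Submodule.subset_span ⟨(β, α), rfl⟩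
  have hext : ∀ A : Sch N →L[ℂ] Sch N, (∀ β α, A * momPos β α ∈ S) → ∀ V ∈ S, A * V ∈ S := by
    intro A hA V hV
    induction hV using Submodule.span_induction with
    | mem x hx => obtain ⟨p, rfl⟩ := hx; exact hA _ _
    | zero => rw [mul_zero]; exact S.zero_mem
    | add x y _ _ hx hy => rw [mul_add]; exact S.add_mem hx hy
    | smul c x _ hx => rw [mul_smul_comm]; exact S.smul_mem _ hx
  -- Stability of the span under left multiplication passes from the generators to products, whereas
  -- membership alone would not; evaluating at 1 concludes.
  have key : ∀ V ∈ S, W * V ∈ S := by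
    induction hW using Algebra.adjoin_induction with
    | mem x hx =>
      rcases hx with ⟨i, rfl⟩ | ⟨i, rfl⟩
      · exact hext _ (posOp_mul_momPos_mem i)
      · exact hext _ fun β α => by rw [momOp_mul_momPos]; exact hmem _ _
    | algebraMap r =>
      intro V hV
      rw [Algebra.algebraMap_eq_smul_one, smul_mul_assoc, one_mul]
      exact S.smul_mem _ hV
    | add x y _ _ hx hy => intro V hV; rw [add_mul]; exact S.add_mem (hx V hV) (hy V hV)
    | mul x y _ _ hx hy => intro V hV; rw [mul_assoc]; exact hx _ (hy V hV)
  have h1 : (1 : Sch N →L[ℂ] Sch N) ∈ S := by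
    have h := hmem (0 : MultiIndex N) 0
    rwa [momPos, tuplePow_zero, tuplePow_zero, one_mul] at h
  have h2 := key 1 h1
  rwa [mul_one] at h2

end NormalOrdering

/-! ### Schwartz operators, their Hermite matrices and operator distributions. -/

section OperatorDistributions

open Filter Topology SchwartzOp

lemma toOp_ketbra (ψ ψ' : Sch N) :
    (ketbra ψ ψ').toOp = InnerProductSpace.rankOne ℂ (vec ψ) (vec ψ') := rfl

lemma toOp_add (S T : SchwartzOp N) : (S + T).toOp = S.toOp + T.toOp := rfl

lemma toOp_smul (c : ℂ) (T : SchwartzOp N) : (c • T).toOp = c • T.toOp := rfl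

lemma toOp_sub (S T : SchwartzOp N) : (S - T).toOp = S.toOp - T.toOp := rfl

lemma toOp_sum {ι : Type*} (s : Finset ι) (f : ι → SchwartzOp N) :
    (∑ i ∈ s, f i).toOp = ∑ i ∈ s, (f i).toOp := by
  induction s using Finset.cons_induction with
  | empty => rfl
  | cons a s ha ih => rw [Finset.sum_cons, Finset.sum_cons, toOp_add, ih]

lemma ketbra_add_left (φ ψ χ : Sch N) : ketbra (φ + ψ) χ = ketbra φ χ + ketbra ψ χ := by
  refine Subtype.ext (ContinuousLinearMap.ext fun f => ?_)
  change inner ℂ (vec χ) f • vec (φ + ψ) = inner ℂ (vec χ) f • vec φ + inner ℂ (vec χ) f • vec ψ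
  rw [vec_add, smul_add]

lemma ketbra_add_right (φ ψ χ : Sch N) : ketbra χ (φ + ψ) = ketbra χ φ + ketbra χ ψ := by
  refine Subtype.ext (ContinuousLinearMap.ext fun f => ?_)
  change inner ℂ (vec (φ + ψ)) f • vec χ = inner ℂ (vec φ) f • vec χ + inner ℂ (vec ψ) f • vec χ
  rw [vec_add, inner_add_left, add_smul]

lemma ketbra_smul_left (c : ℂ) (φ χ : Sch N) : ketbra (c • φ) χ = c • ketbra φ χ := by
  refine Subtype.ext (ContinuousLinearMap.ext fun f => ?_)
  change inner ℂ (vec χ) f • vec (c • φ) = c • inner ℂ (vec χ) f • vec φ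
  rw [vec_smul, smul_comm]

lemma ketbra_smul_right (c : ℂ) (φ χ : Sch N) : ketbra χ (c • φ) = conj c • ketbra χ φ := by
  refine Subtype.ext (ContinuousLinearMap.ext fun f => ?_)
  change inner ℂ (vec (c • φ)) f • vec χ = conj c • inner ℂ (vec φ) f • vec χ
  rw [vec_smul, inner_smul_left, smul_smul]

lemma opSeminorm_le {k : OpIndex N} {T : SchwartzOp N} {M : ℝ}
    (h : ∀ ψ φ : Sch N, ‖vec ψ‖ ≤ 1 → ‖vec φ‖ ≤ 1 →
      ‖inner ℂ (vec (momPos k.2.2.1 k.1 ψ)) (T.toOp (vec (momPos k.2.2.2 k.2.1 φ)))‖ ≤ M) :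
    opSeminorm N k T ≤ M := by
  refine csSup_le (opValues_nonempty k T.toOp) ?_
  rintro r ⟨ψ, φ, h1, h2, rfl⟩
  exact h ψ φ h1 h2

lemma le_opSeminorm (k : OpIndex N) (T : SchwartzOp N) {ψ φ : Sch N} (hψ : ‖vec ψ‖ ≤ 1)
    (hφ : ‖vec φ‖ ≤ 1) :
    ‖inner ℂ (vec (momPos k.2.2.1 k.1 ψ)) (T.toOp (vec (momPos k.2.2.2 k.2.1 φ)))‖
      ≤ opSeminorm N k T :=
  le_csSup (T.property k) ⟨ψ, φ, hψ, hφ, rfl⟩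

/-- Boundedness of `(ψ, φ) ↦ ⟨R ψ, T S φ⟩`, uniformly in terms of the seminorms of `T`. -/
def SeminormBounded (R S : Sch N →L[ℂ] Sch N) : Prop :=
  ∃ s : Finset (OpIndex N), ∃ C : ℝ, 0 ≤ C ∧ ∀ (T : SchwartzOp N) (ψ φ : Sch N),
    ‖vec ψ‖ ≤ 1 → ‖vec φ‖ ≤ 1 →
      ‖inner ℂ (vec (R ψ)) (T.toOp (vec (S φ)))‖ ≤ C * s.sup (opSeminorm N) T

lemma finset_sup_opSeminorm_mono {s t : Finset (OpIndex N)} (h : s ⊆ t) (T : SchwartzOp N) :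
    s.sup (opSeminorm N) T ≤ t.sup (opSeminorm N) T :=
  (Finset.sup_mono h : s.sup (opSeminorm N) ≤ t.sup (opSeminorm N)) T

lemma SeminormBounded.of_norm_le {R S R₁ S₁ R₂ S₂ : Sch N →L[ℂ] Sch N}
    (h1 : SeminormBounded R₁ S₁) (h2 : SeminormBounded R₂ S₂)
    (h : ∀ (T : SchwartzOp N) (ψ φ : Sch N), ‖inner ℂ (vec (R ψ)) (T.toOp (vec (S φ)))‖ ≤
      ‖inner ℂ (vec (R₁ ψ)) (T.toOp (vec (S₁ φ)))‖ +
        ‖inner ℂ (vec (R₂ ψ)) (T.toOp (vec (S₂ φ)))‖) : SeminormBounded R S := by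
  classical
  obtain ⟨s, C, hC, hs⟩ := h1
  obtain ⟨t, D, hD, ht⟩ := h2
  refine ⟨s ∪ t, C + D, by positivity, fun T ψ φ hψ hφ => (h T ψ φ).trans ?_⟩
  rw [add_mul]
  refine add_le_add ((hs T ψ φ hψ hφ).trans ?_) ((ht T ψ φ hψ hφ).trans ?_)
  · exact mul_le_mul_of_nonneg_left
      (finset_sup_opSeminorm_mono Finset.subset_union_left T) hC
  · exact mul_le_mul_of_nonneg_left
      (finset_sup_opSeminorm_mono Finset.subset_union_right T) hD

lemma SeminormBounded.of_norm_eq_mul {R S R₁ S₁ : Sch N →L[ℂ] Sch N}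
    (h1 : SeminormBounded R₁ S₁) (c : ℝ) (hc : 0 ≤ c)
    (h : ∀ (T : SchwartzOp N) (ψ φ : Sch N), ‖inner ℂ (vec (R ψ)) (T.toOp (vec (S φ)))‖ =
      c * ‖inner ℂ (vec (R₁ ψ)) (T.toOp (vec (S₁ φ)))‖) : SeminormBounded R S := by
  obtain ⟨s, C, hC, hs⟩ := h1
  refine ⟨s, c * C, by positivity, fun T ψ φ hψ hφ => (h T ψ φ).le.trans ?_⟩
  rw [mul_assoc]
  exact mul_le_mul_of_nonneg_left (hs T ψ φ hψ hφ) hc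

lemma seminormBounded_zero_left (S : Sch N →L[ℂ] Sch N) : SeminormBounded 0 S :=
  ⟨∅, 0, le_rfl, fun T ψ φ _ _ => by rw [zero_apply, vec_zero]; simp⟩

lemma seminormBounded_zero_right (R : Sch N →L[ℂ] Sch N) : SeminormBounded R 0 :=
  ⟨∅, 0, le_rfl, fun T ψ φ _ _ => by rw [zero_apply, vec_zero]; simp⟩

/-- For normally ordered monomials the estimate is one of the defining seminorms; normal ordering
and sesquilinearity extend it to all polynomials, in particular to powers of H + ½. -/
lemma seminormBounded_polyOps {R S : Sch N →L[ℂ] Sch N} (hR : R ∈ polyOps N)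
    (hS : S ∈ polyOps N) : SeminormBounded R S := by
  have h1 := polyOps_subset_span hR
  have h2 := polyOps_subset_span hS
  clear hR hS
  induction h1 using Submodule.span_induction with
  | mem x hx =>
    obtain ⟨p, rfl⟩ := hx
    induction h2 using Submodule.span_induction with
    | mem y hy =>
      obtain ⟨q, rfl⟩ := hy
      refine ⟨{(p.2, q.2, p.1, q.1)}, 1, zero_le_one, fun T ψ φ hψ hφ => ?_⟩
      rw [Finset.sup_singleton, one_mul]
      exact le_opSeminorm (p.2, q.2, p.1, q.1) T hψ hφ
    | zero => exact seminormBounded_zero_right _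
    | add x y _ _ hx hy =>
      refine SeminormBounded.of_norm_le hx hy fun T ψ φ => ?_
      rw [add_apply, vec_add, map_add, inner_add_right]
      exact norm_add_le _ _
    | smul c x _ hx =>
      refine SeminormBounded.of_norm_eq_mul hx ‖c‖ (norm_nonneg c) fun T ψ φ => ?_
      rw [smul_apply, vec_smul, map_smul, inner_smul_right, norm_mul]
  | zero => exact seminormBounded_zero_left _
  | add x y _ _ hx hy =>
    refine SeminormBounded.of_norm_le hx hy fun T ψ φ => ?_
    rw [add_apply, vec_add, inner_add_left]
    exact norm_add_le _ _
  | smul c x _ hx =>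
    refine SeminormBounded.of_norm_eq_mul hx ‖c‖ (norm_nonneg c) fun T ψ φ => ?_
    rw [smul_apply, vec_smul, inner_smul_left, norm_mul, RCLike.norm_conj]

/-- Matrix elements of an operator between Hermite functions. -/
def matrixElem (T : SchwartzOp N) (m n : MultiIndex N) : ℂ :=
  inner ℂ (vec (herm m)) (T.toOp (vec (herm n)))

/-- The matrix elements of a Schwartz operator are rapidly decreasing. -/
lemma exists_norm_matrixElem_le (β γ : MultiIndex N) :
    ∃ s : Finset (OpIndex N), ∃ C : ℝ, 0 ≤ C ∧ ∀ (T : SchwartzOp N) (m n : MultiIndex N),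
      ‖matrixElem T m n‖ * oscWeight β m * oscWeight γ n
        ≤ C * s.sup (opSeminorm N) T * (invWeight m * invWeight n) := by
  obtain ⟨s, C, hC, h⟩ := seminormBounded_polyOps (N := N)
    (oscPow_mem_polyOps (β + fun _ => 2)) (oscPow_mem_polyOps (γ + fun _ => 2))
  refine ⟨s, C, hC, fun T m n => ?_⟩
  have h1 := h T (herm m) (herm n) (norm_vec_herm m).le (norm_vec_herm n).le
  rw [oscPow_herm, oscPow_herm, vec_smul, vec_smul, map_smul, inner_smul_left, inner_smul_right,
    Complex.conj_ofReal, norm_mul, norm_mul, Complex.norm_real, Complex.norm_real,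
    Real.norm_of_nonneg (oscWeight_pos _ _).le, Real.norm_of_nonneg (oscWeight_pos _ _).le,
    oscWeight_add, oscWeight_add] at h1
  have h2 := oscWeight_pos (fun _ => 2) m
  have h3 := oscWeight_pos (fun _ => 2) n
  have h4 : ‖matrixElem T m n‖ * oscWeight β m * oscWeight γ n
      = (oscWeight β m * oscWeight (fun _ => 2) m * (oscWeight γ n * oscWeight (fun _ => 2) n *
        ‖matrixElem T m n‖)) * (invWeight m * invWeight n) := by
    rw [invWeight, invWeight]
    field_simp
  rw [h4]
  exact mul_le_mul_of_nonneg_right h1 (mul_pos (invWeight_pos m) (invWeight_pos n)).le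

/-- The form `(ψ, φ) ↦ ⟨ψ, T φ⟩` of a Schwartz operator. -/
def formOfOp (T : SchwartzOp N) : SesqForm N :=
  LinearMap.mk₂'ₛₗ (starRingEnd ℂ) (RingHom.id ℂ) (fun ψ φ => inner ℂ (vec ψ) (T.toOp (vec φ)))
    (fun φ ψ χ => by rw [vec_add, inner_add_left])
    (fun c φ χ => by rw [vec_smul, inner_smul_left, smul_eq_mul])
    (fun φ χ χ' => by rw [vec_add, map_add, inner_add_right])
    (fun c φ χ => by rw [vec_smul, map_smul, inner_smul_right]; rfl)

lemma formOfOp_apply (T : SchwartzOp N) (ψ φ : Sch N) :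
    formOfOp T ψ φ = inner ℂ (vec ψ) (T.toOp (vec φ)) := rfl

lemma formOfOp_jointlyContinuous (T : SchwartzOp N) : JointlyContinuous (formOfOp T) :=
  (continuous_vec.comp continuous_fst).inner
    (T.toOp.continuous.comp (continuous_vec.comp continuous_snd))

/-- The error bound depends only on the majorant, which gives uniformity over the unit balls in
`hasSum_ketbra`. -/
lemma norm_tsum_sub_sum_le {ι : Type*} {f : ι → ℂ} {F : ι → ℝ} {a : ℂ} (hf : HasSum f a)
    (hF : Summable F) (hfF : ∀ i, ‖f i‖ ≤ F i) (s : Finset ι) :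
    ‖∑ i ∈ s, f i - a‖ ≤ ∑' i, F i - ∑ i ∈ s, F i := by
  have h1 := hf.summable.sum_add_tsum_subtype_compl s
  have h2 := hF.sum_add_tsum_subtype_compl s
  rw [hf.tsum_eq] at h1
  rw [← h1, ← h2, sub_add_cancel_left, norm_neg, add_sub_cancel_left]
  exact tsum_of_norm_bounded (hF.subtype _).hasSum fun i => hfF i

/-- A Schwartz operator is the sum of its Hermite matrix, in the topology of `𝔖(𝓗)`. -/
lemma hasSum_ketbra (T : SchwartzOp N) :
    HasSum (fun p : MultiIndex N × MultiIndex N =>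
      matrixElem T p.1 p.2 • ketbra (herm p.1) (herm p.2)) T := by
  refine (withSeminorms.tendsto_nhds _ T).2 fun k ε hε => ?_
  obtain ⟨R', hR'm, hR'⟩ := exists_adjoint_mem_polyOps (momPos_mem_polyOps (N := N) k.2.2.1 k.1)
  obtain ⟨S', hS'm, hS'⟩ := exists_adjoint_mem_polyOps (momPos_mem_polyOps (N := N) k.2.2.2 k.2.1)
  obtain ⟨β, C, hC, hβ⟩ := norm_polyOp_le hR'm
  obtain ⟨γ, D, hD, hγ⟩ := norm_polyOp_le hS'm
  -- Moving P^β Q^α onto the Hermite functions by adjoints yields a summable majorant independent of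
  -- the test vectors ψ, φ in the unit ball.
  set F : MultiIndex N × MultiIndex N → ℝ := fun p =>
    ‖matrixElem T p.1 p.2‖ * (‖vec (R' (herm p.1))‖ * ‖vec (S' (herm p.2))‖) with hF
  have hFsum : Summable F := by
    obtain ⟨s, K, hK, h⟩ := exists_norm_matrixElem_le β γ
    refine Summable.of_nonneg_of_le (fun p => by positivity) (fun p => ?_)
      (summable_invWeight_mul.mul_left (C * D * (K * s.sup (opSeminorm N) T)))
    have h1 := hβ (herm p.1)
    have h2 := hγ (herm p.2)
    rw [norm_oscPow_herm] at h1 h2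
    calc F p ≤ ‖matrixElem T p.1 p.2‖ * ((C * oscWeight β p.1) * (D * oscWeight γ p.2)) := by
          have := oscWeight_pos β p.1
          exact mul_le_mul_of_nonneg_left
            (mul_le_mul h1 h2 (norm_nonneg _) (by positivity)) (norm_nonneg _)
      _ = C * D * (‖matrixElem T p.1 p.2‖ * oscWeight β p.1 * oscWeight γ p.2) := by ring
      _ ≤ C * D * (K * s.sup (opSeminorm N) T * (invWeight p.1 * invWeight p.2)) :=
          mul_le_mul_of_nonneg_left (h T p.1 p.2) (by positivity)
      _ = _ := by ring
  have htail : Tendsto (fun s => ∑' p, F p - ∑ p ∈ s, F p) atTop (𝓝 0) := by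
    have h := hFsum.hasSum.const_sub (∑' p, F p)
    rwa [sub_self] at h
  filter_upwards [htail.eventually_lt_const hε] with s hs
  refine lt_of_le_of_lt (opSeminorm_le fun ψ φ hψ hφ => ?_) hs
  have hsum := (formOfOp_jointlyContinuous T).hasSum_herm (momPos k.2.2.1 k.1 ψ) (momPos k.2.2.2 k.2.1 φ)
  have hterm : ∀ p : MultiIndex N × MultiIndex N,
      inner ℂ (vec (momPos k.2.2.1 k.1 ψ)) ((matrixElem T p.1 p.2 • ketbra (herm p.1) (herm p.2)).toOp (vec (momPos k.2.2.2 k.2.1 φ)))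
        = inner ℂ (vec (momPos k.2.2.1 k.1 ψ)) (vec (herm p.1)) * inner ℂ (vec (herm p.2)) (vec (momPos k.2.2.2 k.2.1 φ)) *
          formOfOp T (herm p.1) (herm p.2) := fun p => by
    rw [toOp_smul, toOp_ketbra, smul_apply, InnerProductSpace.rankOne_apply, inner_smul_right,
      inner_smul_right, matrixElem, formOfOp_apply]
    ring
  have hnorm : ∀ p : MultiIndex N × MultiIndex N,
      ‖inner ℂ (vec (momPos k.2.2.1 k.1 ψ)) (vec (herm p.1)) * inner ℂ (vec (herm p.2)) (vec (momPos k.2.2.2 k.2.1 φ)) *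
          formOfOp T (herm p.1) (herm p.2)‖ ≤ F p := fun p => by
    rw [norm_mul, norm_mul, mul_comm, norm_inner_symm, ← hR', ← hS']
    refine mul_le_mul_of_nonneg_left (mul_le_mul ?_ ?_ (norm_nonneg _) (norm_nonneg _))
      (norm_nonneg _)
    · exact (norm_inner_le_norm _ _).trans (mul_le_of_le_one_right (norm_nonneg _) hψ)
    · exact (norm_inner_le_norm _ _).trans (mul_le_of_le_one_right (norm_nonneg _) hφ)
  have hfin := norm_tsum_sub_sum_le hsum hFsum hnorm s
  refine le_trans (le_of_eq ?_) hfin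
  rw [toOp_sub, toOp_sum, sub_apply, sum_apply, inner_sub_right, inner_sum, formOfOp_apply]
  rw [Finset.sum_congr rfl fun p _ => hterm p]

lemma exists_opSeminorm_ketbra_le (k : OpIndex N) :
    ∃ R S : Sch N →L[ℂ] Sch N, ∀ ψ ψ' : Sch N,
      opSeminorm N k (ketbra ψ ψ') ≤ ‖vec (S ψ')‖ * ‖vec (R ψ)‖ := by
  obtain ⟨R, hR⟩ := exists_adjoint_momPos (N := N) k.2.2.1 k.1
  obtain ⟨S, hS⟩ := exists_adjoint_momPos (N := N) k.2.2.2 k.2.1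
  refine ⟨R, S, fun ψ ψ' => opSeminorm_le fun χ φ hχ hφ => ?_⟩
  rw [toOp_ketbra, InnerProductSpace.rankOne_apply, inner_smul_right, norm_mul, ← hS,
    norm_inner_symm (vec (momPos _ _ χ)), ← hR]
  refine mul_le_mul ?_ ?_ (norm_nonneg _) (norm_nonneg _)
  · exact (norm_inner_le_norm _ _).trans (mul_le_of_le_one_right (norm_nonneg _) hφ)
  · exact (norm_inner_le_norm _ _).trans (mul_le_of_le_one_right (norm_nonneg _) hχ)

lemma ketbra_sub_left (φ ψ χ : Sch N) : ketbra (φ - ψ) χ = ketbra φ χ - ketbra ψ χ := by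
  rw [eq_sub_iff_add_eq, ← ketbra_add_left, sub_add_cancel]

lemma ketbra_sub_right (φ ψ χ : Sch N) : ketbra χ (φ - ψ) = ketbra χ φ - ketbra χ ψ := by
  rw [eq_sub_iff_add_eq, ← ketbra_add_right, sub_add_cancel]

lemma continuous_ketbra_left (ψ' : Sch N) : Continuous fun ψ : Sch N => ketbra ψ ψ' := by
  refine continuous_iff_continuousAt.2 fun ψ₀ =>
    (withSeminorms.tendsto_nhds _ _).2 fun k ε hε => ?_
  obtain ⟨R, S, h⟩ := exists_opSeminorm_ketbra_le k
  have h1 : Continuous fun ψ : Sch N => ‖vec (S ψ')‖ * ‖vec (R (ψ - ψ₀))‖ :=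
    continuous_const.mul
      (continuous_vec.comp (R.continuous.comp (continuous_id.sub continuous_const))).norm
  have h2 := h1.tendsto ψ₀
  rw [sub_self, map_zero, vec_zero, norm_zero, mul_zero] at h2
  filter_upwards [h2.eventually_lt_const hε] with ψ hψ
  rw [← ketbra_sub_left]
  exact (h _ _).trans_lt hψ

lemma continuous_ketbra_right (ψ : Sch N) : Continuous fun ψ' : Sch N => ketbra ψ ψ' := by
  refine continuous_iff_continuousAt.2 fun ψ₀ =>
    (withSeminorms.tendsto_nhds _ _).2 fun k ε hε => ?_
  obtain ⟨R, S, h⟩ := exists_opSeminorm_ketbra_le k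
  have h1 : Continuous fun ψ' : Sch N => ‖vec (S (ψ' - ψ₀))‖ * ‖vec (R ψ)‖ :=
    (continuous_vec.comp
      (S.continuous.comp (continuous_id.sub continuous_const))).norm.mul continuous_const
  have h2 := h1.tendsto ψ₀
  rw [sub_self, map_zero, vec_zero, norm_zero, zero_mul] at h2
  filter_upwards [h2.eventually_lt_const hε] with ψ' hψ'
  rw [← ketbra_sub_right]
  exact (h _ _).trans_lt hψ'

/-- The form `(ψ', ψ) ↦ Φ(|ψ⟩⟨ψ'|)` of an operator distribution `Φ`. -/
def formOfDistribution (Φ : OpDistribution N) : SesqForm N :=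
  LinearMap.mk₂'ₛₗ (starRingEnd ℂ) (RingHom.id ℂ) (fun ψ' ψ => Φ (ketbra ψ ψ'))
    (fun φ ψ χ => by rw [ketbra_add_right, map_add])
    (fun c φ χ => by rw [ketbra_smul_right, map_smul])
    (fun φ χ χ' => by rw [ketbra_add_left, map_add])
    (fun c φ χ => by rw [ketbra_smul_left, map_smul]; rfl)

lemma formOfDistribution_apply (Φ : OpDistribution N) (ψ' ψ : Sch N) :
    formOfDistribution Φ ψ' ψ = Φ (ketbra ψ ψ') := rfl

lemma formOfDistribution_jointlyContinuous (Φ : OpDistribution N) :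
    JointlyContinuous (formOfDistribution Φ) :=
  SeparatelyContinuous.jointlyContinuous ⟨fun ψ => Φ.continuous.comp (continuous_ketbra_right ψ),
    fun ψ' => Φ.continuous.comp (continuous_ketbra_left ψ')⟩

/-- By `hasSum_ketbra` a continuous functional is determined by its values on the rank-one operators
|h_m⟩⟨h_n|. -/
lemma formOfDistribution_injective :
    Function.Injective (formOfDistribution : OpDistribution N → SesqForm N) := by
  intro Φ Φ' h
  ext T
  have h1 : ∀ ψ ψ' : Sch N, Φ (ketbra ψ ψ') = Φ' (ketbra ψ ψ') := fun ψ ψ' => by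
    rw [← formOfDistribution_apply, h, formOfDistribution_apply]
  have h2 := (hasSum_ketbra T).mapL Φ
  have h3 := (hasSum_ketbra T).mapL Φ'
  simp only [map_smul, h1] at h2 h3
  exact h2.unique h3

/-- Continuity and linearity force Φ(T) = Σ T_mn B(h_n, h_m). The matrix of B grows polynomially,
and the rapid decay of T_mn absorbs this with a bound by finitely many seminorms of T. -/
lemma JointlyContinuous.exists_distribution {B : SesqForm N} (hB : JointlyContinuous B) :
    ∃ Φ : OpDistribution N, formOfDistribution Φ = B := by
  obtain ⟨β, β', C, hC, hbd⟩ := hB.exists_bound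
  -- The indices are exchanged because |h_m⟩⟨h_n| corresponds to B(h_n, h_m); the same exchange
  -- explains `Equiv.prodComm` below.
  obtain ⟨s, D, hD, hs⟩ := exists_norm_matrixElem_le β' β
  set term : SchwartzOp N → MultiIndex N × MultiIndex N → ℂ := fun T p =>
    matrixElem T p.1 p.2 * B (herm p.2) (herm p.1) with hterm
  have hle : ∀ T p, ‖term T p‖ ≤
      C * (D * s.sup (opSeminorm N) T) * (invWeight p.1 * invWeight p.2) := fun T p => by
    have h1 := hbd (herm p.2) (herm p.1)
    rw [norm_oscPow_herm, norm_oscPow_herm] at h1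
    calc ‖term T p‖ = ‖matrixElem T p.1 p.2‖ * ‖B (herm p.2) (herm p.1)‖ := norm_mul _ _
      _ ≤ ‖matrixElem T p.1 p.2‖ * (C * oscWeight β p.2 * oscWeight β' p.1) :=
          mul_le_mul_of_nonneg_left h1 (norm_nonneg _)
      _ = C * (‖matrixElem T p.1 p.2‖ * oscWeight β' p.1 * oscWeight β p.2) := by ring
      _ ≤ C * (D * s.sup (opSeminorm N) T * (invWeight p.1 * invWeight p.2)) :=
          mul_le_mul_of_nonneg_left (hs T p.1 p.2) hC.le
      _ = _ := by ring
  have hsum : ∀ T, Summable (term T) := fun T =>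
    Summable.of_norm_bounded (summable_invWeight_mul.mul_left _) (hle T)
  have hbound : ∀ T, ‖∑' p, term T p‖ ≤ C * D *
      (∑' p : MultiIndex N × MultiIndex N, invWeight p.1 * invWeight p.2) *
        s.sup (opSeminorm N) T := fun T => by
    refine (tsum_of_norm_bounded (summable_invWeight_mul.hasSum.mul_left _) (hle T)).trans_eq ?_
    ring
  let L : SchwartzOp N →ₗ[ℂ] ℂ :=
    { toFun := fun T => ∑' p, term T p
      map_add' := fun S T => by
        rw [← (hsum S).tsum_add (hsum T)]
        refine tsum_congr fun p => ?_
        simp only [hterm, matrixElem, toOp_add, add_apply, inner_add_right, add_mul]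
      map_smul' := fun c T => by
        rw [RingHom.id_apply, smul_eq_mul, ← tsum_mul_left]
        refine tsum_congr fun p => ?_
        simp only [hterm, matrixElem, toOp_smul, smul_apply, inner_smul_right, mul_assoc] }
  have hK : 0 ≤ C * D *
      (∑' p : MultiIndex N × MultiIndex N, invWeight p.1 * invWeight p.2) :=
    mul_nonneg (by positivity)
      (tsum_nonneg fun p => (mul_pos (invWeight_pos _) (invWeight_pos _)).le)
  have hcont : Continuous L :=
    withSeminorms.continuous_normedSpace_rng ℂ L ⟨s, ⟨_, hK⟩, fun T => hbound T⟩
  refine ⟨⟨L, hcont⟩, ?_⟩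
  ext ψ' ψ
  rw [formOfDistribution_apply]
  change ∑' p, term (ketbra ψ ψ') p = B ψ' ψ
  have h1 := hB.hasSum_herm ψ' ψ
  rw [← (Equiv.prodComm (MultiIndex N) (MultiIndex N)).hasSum_iff] at h1
  rw [← h1.tsum_eq]
  refine tsum_congr fun p => ?_
  simp only [hterm, matrixElem, toOp_ketbra, InnerProductSpace.rankOne_apply, inner_smul_right,
    Function.comp_apply, Equiv.prodComm_apply, Prod.fst_swap, Prod.snd_swap]

/-- Continuous sesquilinear forms correspond to operator distributions. -/
def formEquivDistribution (N : ℕ) :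
    {B : SesqForm N // JointlyContinuous B} ≃ OpDistribution N :=
  (Equiv.ofBijective
    (fun Φ : OpDistribution N => (⟨formOfDistribution Φ, formOfDistribution_jointlyContinuous Φ⟩ :
      {B : SesqForm N // JointlyContinuous B}))
    ⟨fun _ _ h => formOfDistribution_injective (congrArg Subtype.val h), fun B =>
      B.2.exists_distribution.imp fun _ h => Subtype.ext h⟩).symm

lemma formEquivDistribution_apply (B : {B : SesqForm N // JointlyContinuous B}) (ψ ψ' : Sch N) :
    B.1 ψ' ψ = formEquivDistribution N B (ketbra ψ ψ') := by
  obtain ⟨Φ, rfl⟩ := (formEquivDistribution N).symm.surjective B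
  rw [Equiv.apply_symm_apply]
  rfl

end OperatorDistributions

end QHarm

end

theorem mainTheorem9 (N : ℕ) :
    (∀ β : QHarm.MultiIndex N, Function.Bijective (QHarm.oscPow β)) ∧
    (∀ B : QHarm.SesqForm N,
      List.TFAE
        [QHarm.SeparatelyContinuous B,
         QHarm.JointlyContinuous B,
         QHarm.OscBounded B,
         QHarm.HilbertSchmidtRegular B]) ∧
    (∃ e : {B : QHarm.SesqForm N // QHarm.JointlyContinuous B} ≃ QHarm.OpDistribution N,
      ∀ B, ∀ ψ ψ' : QHarm.Sch N, B.1 ψ' ψ = e B (QHarm.ketbra ψ ψ')) ∧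
    (∃ e : {B : QHarm.SesqForm N // QHarm.JointlyContinuous B} ≃
        (QHarm.Sch N →L[ℂ] 𝓢'(QHarm.Conf N, ℂ)),
      ∀ B, ∀ ψ ψ' : QHarm.Sch N, B.1 ψ' ψ = e B ψ (QHarm.conjSch ψ')) := by
  refine ⟨QHarm.oscPow_bijective, QHarm.tfae_regular,
    ⟨QHarm.formEquivDistribution N, QHarm.formEquivDistribution_apply⟩,
    ⟨QHarm.formEquivMap N, fun B ψ ψ' => ?_⟩⟩
  change B.1 ψ' ψ = B.1 (QHarm.conjSch (QHarm.conjSch ψ')) ψ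
  rw [QHarm.conjSch_conjSch]
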